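/- **Theorem (Differentially private minibatch SGLD).** Let $\mathcal X$ be a set, $1\le\tau\le N$ integers, $L\ge 0$, and for every $x\in\mathcal X$ let $\theta\mapsto\ell(x|\theta)$ be a differentiable function on $\mathbb R^d$ that is $L$-Lipschitz in $\|\cdot\|_2$; let $r:\mathbb R^d\to\mathbb R$ be differentiable, $\eta_t>0$ step sizes, $0<\delta<1$, $0<\varepsilon<2\sqrt{\log(2/\delta)}$, and let $T$ be a real number with $$T\ \ge\ \frac{\varepsilon^2 N}{32\,\tau\log(2/\delta)} .$$ Given a data set $X=(x_1,\dots,x_N)\in\mathcal X^N$, DP-SGLD draws $\theta_1$ from a probability distribution $\mu_1$ on $\mathbb R^d$ that does not depend on $X$ and, for $t=1,\dots,\lfloor NT/\tau\rfloor$, independently draws a uniformly random subset $S_t\subset\{1,\dots,N\}$ of size $\tau$ and a Gaussian vector $z_t\sim\mathcal N(0,\sigma_t^2 I_d)$ with $$\sigma_t^2=\max\Big\{\frac{128NTL^2}{\tau\varepsilon^2}\log\Big(\frac{2.5NT}{\tau\delta}\Big)\log\Big(\frac2\delta\Big)\,\eta_t^2,\ \eta_t\Big\},$$ and sets $$\theta_{t+1}=\theta_t-\eta_t\Big(\nabla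 r(\theta_t)+\frac N\tau\sum_{i\in S_t}\nabla_\theta\ell(x_i|\theta_t)\Big)+z_t .$$ It releases the whole sequence $(\theta_1,\dots,\theta_{\lfloor NT/\tau\rfloor+1})$. Then DP-SGLD is $(\varepsilon,\delta)$-differentially private: if $X,Y\in\mathcal X^N$ differ in at most one entry, then for every measurable set $A$ of sequences, the released sequence $M(\cdot)$ satisfies $\mathbb P(M(X)\in A)\le e^{\varepsilon}\,\mathbb P(M(Y)\in A)+\delta$. The same holds if $\sigma_t^2$ is replaced by any variances $v_t\ge 0$ with $v_t\ge \frac{128NTL^2}{\tau\varepsilon^2}\log\big(\frac{2.5NT}{\tau\delta}\big)\log\big(\frac2\delta\big)\eta_t^2$ for all $t$. -/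

import Mathlib

open MeasureTheory ProbabilityTheory
open scoped ENNReal NNReal

noncomputable section

open scoped Classical in
/-- A randomized algorithm on data sets `X ∈ 𝒳^N`, given by the law `M X` of its output, is
`(ε, δ)`-differentially private: for all data sets at Hamming distance at most one and all
measurable events `S`, `P(M(X) ∈ S) ≤ e^ε P(M(Y) ∈ S) + δ`. -/
def IsDifferentiallyPrivate {𝒳 Ω : Type*} [MeasurableSpace Ω] {N : ℕ}
    (M : (Fin N → 𝒳) → Measure Ω) (ε δ : ℝ) : Prop :=
  ∀ X Y : Fin N → 𝒳, hammingDist X Y ≤ 1 → ∀ S : Set Ω, MeasurableSet S →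
    M X S ≤ ENNReal.ofReal (Real.exp ε) * M Y S + ENNReal.ofReal δ

namespace SGLD

/-- The law on `ℝ^d` of a vector whose coordinates are i.i.d. `𝒩(0, v)`. -/
def isoGaussian (d : ℕ) (v : ℝ≥0) : Measure (EuclideanSpace ℝ (Fin d)) :=
  (Measure.pi fun _ : Fin d => gaussianReal 0 v).map (WithLp.toLp 2)

instance (d : ℕ) (v : ℝ≥0) : IsProbabilityMeasure (isoGaussian d v) :=
  Measure.isProbabilityMeasure_map (by fun_prop)

variable {𝒳 : Type*} {d N : ℕ}

/-- The noiseless part of one update with step size `η` and minibatch `S`: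
`θ - η (∇ r(θ) + (N / τ) ∑_{i ∈ S} ∇ ℓ(x_i | θ))`, gradients being taken in `θ`. -/
def gradStep (ℓ : 𝒳 → EuclideanSpace ℝ (Fin d) → ℝ) (r : EuclideanSpace ℝ (Fin d) → ℝ)
    (τ : ℕ) (η : ℝ) (X : Fin N → 𝒳) (S : Finset (Fin N)) (θ : EuclideanSpace ℝ (Fin d)) :
    EuclideanSpace ℝ (Fin d) :=
  θ - η • (gradient r θ + ((N : ℝ) / (τ : ℝ)) • ∑ i ∈ S, gradient (ℓ (X i)) θ)

lemma measurable_gradient (f : EuclideanSpace ℝ (Fin d) → ℝ) : Measurable (gradient f) :=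
  (InnerProductSpace.toDual ℝ (EuclideanSpace ℝ (Fin d))).symm.continuous.measurable.comp
    (measurable_fderiv ℝ f)

lemma measurable_gradStep (ℓ : 𝒳 → EuclideanSpace ℝ (Fin d) → ℝ)
    (r : EuclideanSpace ℝ (Fin d) → ℝ) (τ : ℕ) (η : ℝ) (X : Fin N → 𝒳) (S : Finset (Fin N)) :
    Measurable (gradStep ℓ r τ η X S) := by
  have h1 : Measurable fun θ => ∑ i ∈ S, gradient (ℓ (X i)) θ :=
    Finset.measurable_sum S fun i _ => measurable_gradient (ℓ (X i))
  have h2 := measurable_gradient r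
  unfold gradStep
  exact measurable_id.sub ((h2.add (h1.const_smul ((N : ℝ) / (τ : ℝ)))).const_smul η)

/-- The transition kernel of one update: given the current iterate `θ`, a minibatch `S` of size `τ`
is drawn uniformly among the `N.choose τ` subsets of `[N]` of that size, an independent
`z ∼ 𝒩(0, v I_d)` is drawn, and the next iterate is `gradStep … S θ + z`. -/
def stepKernel (ℓ : 𝒳 → EuclideanSpace ℝ (Fin d) → ℝ) (r : EuclideanSpace ℝ (Fin d) → ℝ)
    (τ : ℕ) (η : ℝ) (v : ℝ≥0) (X : Fin N → 𝒳) :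
    Kernel (EuclideanSpace ℝ (Fin d)) (EuclideanSpace ℝ (Fin d)) where
  toFun θ := (N.choose τ : ℝ≥0∞)⁻¹ •
    ∑ S ∈ Finset.powersetCard τ (Finset.univ : Finset (Fin N)),
      (isoGaussian d v).map (fun z => gradStep ℓ r τ η X S θ + z)
  measurable' := by
    refine Measure.measurable_of_measurable_coe _ fun A hA => ?_
    simp only [Measure.smul_apply, Measure.finsetSum_apply, smul_eq_mul]
    refine Measurable.const_mul (Finset.measurable_sum _ fun S _ => ?_) _
    have h (θ : EuclideanSpace ℝ (Fin d)) :
        (isoGaussian d v).map (fun z => gradStep ℓ r τ η X S θ + z) A =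
          isoGaussian d v (Prod.mk θ ⁻¹'
            ((fun p : EuclideanSpace ℝ (Fin d) × EuclideanSpace ℝ (Fin d) =>
              gradStep ℓ r τ η X S p.1 + p.2) ⁻¹' A)) := by
      rw [Measure.map_apply (measurable_const_add _) hA]
      rfl
    simp only [h]
    exact measurable_measure_prodMk_left
      ((((measurable_gradStep ℓ r τ η X S).comp measurable_fst).add measurable_snd) hA)

/-- The joint law of the iterates `(θ_1, …, θ_{K+1})` after `K` updates, where `θ_1 ∼ μ₁` and the
update from `θ_t` to `θ_{t+1}` uses the step size `η t` and the noise variance `v t`. The iterate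
`θ_t` is the entry with index `t - 1` of the sequence. -/
def iterates (ℓ : 𝒳 → EuclideanSpace ℝ (Fin d) → ℝ) (r : EuclideanSpace ℝ (Fin d) → ℝ)
    (τ : ℕ) (η : ℕ → ℝ) (v : ℕ → ℝ≥0) (μ₁ : Measure (EuclideanSpace ℝ (Fin d)))
    (X : Fin N → 𝒳) : (K : ℕ) → Measure (Fin (K + 1) → EuclideanSpace ℝ (Fin d))
  | 0 => μ₁.map (fun θ _ => θ)
  | K + 1 =>
    (iterates ℓ r τ η v μ₁ X K ⊗ₘ
      (stepKernel ℓ r τ (η (K + 1)) (v (K + 1)) X).comap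
        (fun θ : Fin (K + 1) → EuclideanSpace ℝ (Fin d) => θ (Fin.last K))
        (measurable_pi_apply _)).map
      (fun p => (Fin.snoc p.1 p.2 : Fin (K + 2) → EuclideanSpace ℝ (Fin d)))

lemma isMarkovKernel_stepKernel (ℓ : 𝒳 → EuclideanSpace ℝ (Fin d) → ℝ)
    (r : EuclideanSpace ℝ (Fin d) → ℝ) {τ : ℕ} (hτ : τ ≤ N) (η : ℝ) (v : ℝ≥0) (X : Fin N → 𝒳) :
    IsMarkovKernel (stepKernel ℓ r τ η v X) := by
  refine ⟨fun θ => ⟨?_⟩⟩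
  have h (S : Finset (Fin N)) :
      (isoGaussian d v).map (fun z => gradStep ℓ r τ η X S θ + z) Set.univ = 1 := by
    rw [Measure.map_apply (measurable_const_add _) MeasurableSet.univ]
    simp
  simp only [stepKernel, Kernel.coe_mk, Measure.smul_apply, Measure.finsetSum_apply, h,
    Finset.sum_const, Finset.card_powersetCard, Finset.card_univ, Fintype.card_fin, smul_eq_mul,
    nsmul_eq_mul, mul_one]
  exact ENNReal.inv_mul_cancel (by exact_mod_cast (Nat.choose_pos hτ).ne') (by simp)

lemma measurable_snoc (K : ℕ) :
    Measurable (fun p : (Fin (K + 1) → EuclideanSpace ℝ (Fin d)) × EuclideanSpace ℝ (Fin d) =>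
      (Fin.snoc p.1 p.2 : Fin (K + 2) → EuclideanSpace ℝ (Fin d))) := by
  refine measurable_pi_lambda _ fun i => ?_
  induction i using Fin.lastCases with
  | last => simpa using measurable_snd
  | cast i =>
    simp only [Fin.snoc_castSucc]
    exact (measurable_pi_apply i).comp measurable_fst

lemma isProbabilityMeasure_iterates (ℓ : 𝒳 → EuclideanSpace ℝ (Fin d) → ℝ)
    (r : EuclideanSpace ℝ (Fin d) → ℝ) {τ : ℕ} (hτ : τ ≤ N) (η : ℕ → ℝ) (v : ℕ → ℝ≥0)
    (μ₁ : Measure (EuclideanSpace ℝ (Fin d))) [IsProbabilityMeasure μ₁] (X : Fin N → 𝒳) (K : ℕ) :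
    IsProbabilityMeasure (iterates ℓ r τ η v μ₁ X K) := by
  induction K with
  | zero => exact Measure.isProbabilityMeasure_map (by fun_prop)
  | succ K ih =>
    have := isMarkovKernel_stepKernel ℓ r hτ (η (K + 1)) (v (K + 1)) X
    exact Measure.isProbabilityMeasure_map (measurable_snoc K).aemeasurable

/-- The factor `(128 N T L² / (τ ε²)) log(2.5 N T / (τ δ)) log(2 / δ)` multiplying `η_t²` in the
noise variance. -/
def privacyFactor (N τ : ℕ) (T ε δ L : ℝ) : ℝ :=
  128 * N * T * L ^ 2 / (τ * ε ^ 2) * Real.log (2.5 * N * T / (τ * δ)) * Real.log (2 / δ)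

/-- The noise variance `privacyFactor · η² ∨ η` of DP-SGLD at step size `η`. -/
def privateVariance (N τ : ℕ) (T ε δ L η : ℝ) : ℝ≥0 :=
  Real.toNNReal (max (privacyFactor N τ T ε δ L * η ^ 2) η)

/-- DP-SGLD: `⌊N T / τ⌋` updates with noise variance `privateVariance` at each step; the whole
sequence `θ_1, …, θ_{⌊N T / τ⌋ + 1}` is released. -/
def dpSGLD (ℓ : 𝒳 → EuclideanSpace ℝ (Fin d) → ℝ) (r : EuclideanSpace ℝ (Fin d) → ℝ)
    (τ : ℕ) (T ε δ L : ℝ) (η : ℕ → ℝ) (μ₁ : Measure (EuclideanSpace ℝ (Fin d)))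
    (X : Fin N → 𝒳) : Measure (Fin (⌊(N : ℝ) * T / τ⌋₊ + 1) → EuclideanSpace ℝ (Fin d)) :=
  iterates ℓ r τ η (fun t => privateVariance N τ T ε δ L (η t)) μ₁ X ⌊(N : ℝ) * T / τ⌋₊

end SGLD

end

/-!
# Differential privacy of minibatch SGLD

Fix two data sets that differ at one index `j`. One update has as its law a mixture, over the
minibatches `S`, of Gaussians centred at the noiseless steps, and only the components with `j ∈ S`, a
fraction `q = τ / N` of the mass, see the difference. Replacing `j` by a uniformly random index in a
uniformly random minibatch that contains `j` gives a uniformly random minibatch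
(`SGLD.sum_swapPairs`). So the mixture splits into groups in which all the means are within the
sensitivity `2 η (N / τ) L` of one another and a fraction `q` of the mass is moved by the change of
data.

In terms of the densities `pX`, `pY` of one update this gives two bounds, both linear in the groups
(`SGLD.isApproxDensity_mixture`):

* the mass of `pX` above `(1 + q (e^t - 1)) pY` is at most `q` times a Gaussian tail, by a Chernoff
  bound;
* the `χ²` divergence of `pX` from `pY` is of order `q²`, by joint convexity of `(u, w) ↦ u² / w`.

Hence the density ratio `pX / pY`, cut off at `1 + q (e^t - 1)`, represents the update for the first
data set by the one for the second up to a small exceptional mass, and its moments exceed `1` only by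
a term of order `q²`. Such approximate densities compose (`IsApproxDensity.compProd`): densities
multiply and exceptional masses add up.

With `K = N T / τ`, `a = log (2 / δ)`, `b = log (2.5 K / δ)` the noise is calibrated so that
`t = ε / (4 q √(a K))` is at most `√2` and the squared sensitivity is at most `t² / (2 b)` times the
variance. The exceptional masses then add up to at most `δ / 2`. If `K` is at most a constant times
`a`, the cut-offs multiply to at most `e^ε` (`pow_cutoff_le`). Otherwise Markov's inequality for the
moment of order `1 + 2 a / ε` of the composed density bounds its mass above `e^ε` by
`e^(-a) = δ / 2` (`pow_moment_mul_exp_le`).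
-/

/-! ### Elementary inequalities -/

lemma exp_le_one_add_add_sq {x : ℝ} (hx : x ≤ 17 / 10) : Real.exp x ≤ 1 + x + x ^ 2 := by
  rcases le_or_gt x 0 with h0 | h0
  · -- for `x ≤ 0` the reciprocal of `1 - x + x² / 2 ≤ exp (-x)` is small enough
    have h1 : 1 + (-x) + (-x) ^ 2 / 2 ≤ Real.exp (-x) := Real.quadratic_le_exp_of_nonneg (by linarith)
    have h2 : Real.exp x * Real.exp (-x) = 1 := by rw [← Real.exp_add]; simp
    have h3 := Real.exp_pos x
    nlinarith [sq_nonneg x, sq_nonneg (x + 1), mul_nonneg (neg_nonneg.2 h0) (sq_nonneg x),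
      mul_le_mul_of_nonneg_left h1 h3.le, sq_nonneg (x ^ 2), mul_nonneg h3.le (sq_nonneg x)]
  · obtain ⟨y, rfl⟩ : ∃ y, x = 2 * y := ⟨x / 2, by ring⟩
    have h1 := Real.exp_bound' (x := y) (by linarith) (by linarith) (n := 4) (by norm_num)
    simp only [Finset.sum_range_succ, Finset.sum_range_zero, Nat.factorial] at h1
    norm_num at h1
    have h2 : Real.exp (2 * y) = Real.exp y ^ 2 := by rw [← Real.exp_nat_mul]; norm_num
    rw [h2]
    -- `1 / 6 + (17 / 20) * 5 / 96 < 11 / 50` absorbs the quartic term into the cubic one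
    have h3 : Real.exp y ≤ 1 + y + y ^ 2 / 2 + y ^ 3 * (11 / 50) := by
      have : 0 ≤ y ^ 3 * (1 - 20 / 17 * y) :=
        mul_nonneg (pow_nonneg (by linarith) 3) (by linarith)
      nlinarith
    have h4 := pow_le_pow_left₀ (Real.exp_pos y).le h3 2
    refine h4.trans ?_
    have h5 : y ≤ 17 / 20 := by linarith
    have h6 : 0 ≤ y := by linarith
    have : 0 ≤ y ^ 2 * (2 - (2 * (11/50) + 1) * y - (1/4 + 2 * (11/50)) * y ^ 2
        - 11/50 * y ^ 3 - (11/50) ^ 2 * y ^ 4) := by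
      refine mul_nonneg (by positivity) ?_
      have e2 : y ^ 2 ≤ (17/20) ^ 2 := by gcongr
      have e3 : y ^ 3 ≤ (17/20) ^ 3 := by gcongr
      have e4 : y ^ 4 ≤ (17/20) ^ 4 := by gcongr
      nlinarith
    nlinarith

/-- A Chernoff bound for densities `x`, `y`, `z` at a point. As `y + (e^t - 1) z` is at least `e^t`
times the smaller of `y` and `z`, it reduces to one reference density `w`, for which
`1 - 1 / u ≤ u ^ l / 4` with `u = x / (e^t w)`. -/
lemma sub_sub_le_rpow {x y z t l : ℝ} (hx : 0 < x) (hy : 0 < y) (hz : 0 < z) (ht : 0 ≤ t)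
    (hl : 1 ≤ l) :
    x - y - (Real.exp t - 1) * z ≤
      4⁻¹ * Real.exp (-(l * t)) * (x * (x / y) ^ l + x * (x / z) ^ l) := by
  have key : ∀ w : ℝ, 0 < w → x - Real.exp t * w ≤ 4⁻¹ * Real.exp (-(l * t)) * (x * (x / w) ^ l) := by
    intro w hw
    have e1 : Real.exp (-(l * t)) * (x / w) ^ l = (x / (Real.exp t * w)) ^ l := by
      rw [show x / (Real.exp t * w) = (x / w) * Real.exp (-t) by
        rw [Real.exp_neg]; field_simp, Real.mul_rpow (by positivity) (by positivity),
        ← Real.exp_mul, mul_comm]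
      congr 2; ring
    have e2 : 4⁻¹ * Real.exp (-(l * t)) * (x * (x / w) ^ l) =
        4⁻¹ * x * (x / (Real.exp t * w)) ^ l := by rw [← e1]; ring
    rw [e2]
    set u := Real.exp t * w with hu
    have hu0 : 0 < u := by positivity
    rcases le_or_gt x u with h | h
    · exact (sub_nonpos.2 h).trans (by positivity)
    · have h1 : x / u ≤ (x / u) ^ l := by
        conv_lhs => rw [← Real.rpow_one (x / u)]
        exact Real.rpow_le_rpow_of_exponent_le ((one_le_div hu0).2 h.le) hl
      have h2 : x - u ≤ 4⁻¹ * x * (x / u) := by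
        rw [show 4⁻¹ * x * (x / u) = x ^ 2 / (4 * u) by field_simp, le_div_iff₀ (by positivity)]
        nlinarith [sq_nonneg (x - 2 * u)]
      exact h2.trans (by gcongr)
  have hc : 0 ≤ Real.exp t - 1 := by linarith [Real.add_one_le_exp t]
  have hy' : 0 ≤ 4⁻¹ * Real.exp (-(l * t)) * (x * (x / y) ^ l) := by positivity
  have hz' : 0 ≤ 4⁻¹ * Real.exp (-(l * t)) * (x * (x / z) ^ l) := by positivity
  rw [mul_add]
  rcases le_total y z with h | h
  · nlinarith [key y hy, mul_le_mul_of_nonneg_left h hc]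
  · nlinarith [key z hz]

/-- When `A`, `B` and `D` are the squared side lengths of a triangle, the exponent `(A + B - D) / 2`
is an inner product, and the left side is a `χ²`-type divergence of Gaussians. -/
lemma exp_add_exp_sub_two_mul_exp_le {A B D s : ℝ} (hA0 : 0 ≤ A) (hB0 : 0 ≤ B) (hA : A ≤ s)
    (hB : B ≤ s) (hD : D ≤ s) :
    Real.exp A + Real.exp B - 2 * Real.exp ((A + B - D) / 2) ≤ s * Real.exp s := by
  have e : ∀ z : ℝ, Real.exp z = Real.exp (z / 2) ^ 2 := fun z => by
    rw [← Real.exp_nat_mul]; congr 1; push_cast; ring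
  have hs : Real.exp ((A + B - D) / 2) = Real.exp (A / 2) * Real.exp (B / 2) * Real.exp (-D / 2) := by
    rw [← Real.exp_add, ← Real.exp_add]; congr 1; ring
  have hgE : Real.exp (-s / 2) * Real.exp (s / 2) = 1 := by
    rw [← Real.exp_add, ← Real.exp_zero]; congr 1; ring
  have hgD : Real.exp (-s / 2) ≤ Real.exp (-D / 2) := Real.exp_le_exp.2 (by linarith)
  have hg : 1 - s / 2 ≤ Real.exp (-s / 2) := by linarith [Real.add_one_le_exp (-s / 2)]
  have a1 : 1 ≤ Real.exp (A / 2) := Real.one_le_exp (by linarith)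
  have b1 : 1 ≤ Real.exp (B / 2) := Real.one_le_exp (by linarith)
  have aE : Real.exp (A / 2) ≤ Real.exp (s / 2) := Real.exp_le_exp.2 (by linarith)
  have bE : Real.exp (B / 2) ≤ Real.exp (s / 2) := Real.exp_le_exp.2 (by linarith)
  rw [hs, e A, e B, e s]
  have g0 := Real.exp_pos (-s / 2)
  generalize Real.exp (A / 2) = α at *
  generalize Real.exp (B / 2) = β at *
  generalize Real.exp (s / 2) = E at *
  generalize Real.exp (-s / 2) = g at *
  generalize Real.exp (-D / 2) = γ at *
  have h1 : α * β * g ≤ α * β * γ := by gcongr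
  have h2 : 0 ≤ (E - α) * (E + α - 2 * (g * E)) :=
    mul_nonneg (by linarith) (by rw [hgE]; linarith)
  have hga : g * α ≤ 1 := by rw [← hgE]; gcongr
  have h3 : 0 ≤ (E - β) * (E + β - 2 * (g * α)) := mul_nonneg (by linarith) (by linarith)
  have h4 : 0 ≤ E ^ 2 * (g - (1 - s / 2)) := mul_nonneg (by positivity) (by linarith)
  nlinarith

/-! ### Densities of isotropic Gaussian laws -/

namespace SGLD

/-- The Lebesgue density on `ℝ^d` of the normal law with mean `m` and covariance `v I_d`. -/
noncomputable def isoPDF (d : ℕ) (v : ℝ≥0) (m y : EuclideanSpace ℝ (Fin d)) : ℝ :=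
  ∏ i, gaussianPDFReal (m i) v (y i)

variable {d : ℕ} {v : ℝ≥0}

lemma isoPDF_eq (m y : EuclideanSpace ℝ (Fin d)) :
    isoPDF d v m y = (√(2 * Real.pi * v))⁻¹ ^ d * Real.exp (-(‖y - m‖ ^ 2 / (2 * v))) := by
  simp only [isoPDF, gaussianPDFReal_def, Finset.prod_mul_distrib, Finset.prod_const,
    Finset.card_univ, Fintype.card_fin, ← Real.exp_sum, EuclideanSpace.norm_sq_eq,
    Finset.sum_div, ← Finset.sum_neg_distrib, PiLp.sub_apply, Real.norm_eq_abs, sq_abs, neg_div]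

lemma isoPDF_pos (hv : v ≠ 0) (m y : EuclideanSpace ℝ (Fin d)) : 0 < isoPDF d v m y :=
  Finset.prod_pos fun _ _ => gaussianPDFReal_pos _ _ _ hv

lemma measurable_isoPDF_comp {α : Type*} [MeasurableSpace α]
    {f g : α → EuclideanSpace ℝ (Fin d)} (hf : Measurable f) (hg : Measurable g) :
    Measurable fun x => isoPDF d v (f x) (g x) := by
  simp only [isoPDF_eq]
  fun_prop

lemma integrable_isoPDF (m : EuclideanSpace ℝ (Fin d)) : Integrable (isoPDF d v m) := by
  have h : Integrable (fun y : Fin d → ℝ => ∏ i, gaussianPDFReal (m i) v (y i)) :=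
    Integrable.fintype_prod_dep fun i => integrable_gaussianPDFReal (m i) v
  exact ((PiLp.volume_preserving_ofLp (Fin d)).integrable_comp_emb
    (MeasurableEquiv.toLp 2 (Fin d → ℝ)).symm.measurableEmbedding).2 h

lemma integral_isoPDF (hv : v ≠ 0) (m : EuclideanSpace ℝ (Fin d)) :
    ∫ y, isoPDF d v m y = 1 := by
  have h := (PiLp.volume_preserving_ofLp (Fin d)).integral_comp
    (MeasurableEquiv.toLp 2 (Fin d → ℝ)).symm.measurableEmbedding
    (fun y : Fin d → ℝ => ∏ i, gaussianPDFReal (m i) v (y i))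
  refine h.trans ?_
  rw [integral_fintype_prod_volume_eq_prod (fun i => gaussianPDFReal (m i) v)]
  simp [integral_gaussianPDFReal_eq_one _ hv]

lemma pi_gaussianReal_eq_withDensity (hv : v ≠ 0) (m : Fin d → ℝ) :
    (Measure.pi fun i => gaussianReal (m i) v) =
      volume.withDensity fun y => ENNReal.ofReal (∏ i, gaussianPDFReal (m i) v (y i)) := by
  refine Measure.pi_eq fun s hs => ?_
  rw [withDensity_apply _ (MeasurableSet.univ_pi hs), ← ofReal_integral_eq_lintegral_ofReal,
    ← integral_indicator (MeasurableSet.univ_pi hs)]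
  · have h : (Set.univ.pi s).indicator (fun y : Fin d → ℝ => ∏ i, gaussianPDFReal (m i) v (y i)) =
        fun y => ∏ i, (s i).indicator (gaussianPDFReal (m i) v) (y i) := by
      ext y
      by_cases hy : y ∈ Set.univ.pi s
      · rw [Set.indicator_of_mem hy]
        exact Finset.prod_congr rfl fun i _ => (Set.indicator_of_mem (hy i trivial) _).symm
      · rw [Set.indicator_of_notMem hy]
        obtain ⟨i, hi⟩ : ∃ i, y i ∉ s i := by simpa [Set.mem_pi] using hy
        exact (Finset.prod_eq_zero (Finset.mem_univ i) (Set.indicator_of_notMem hi _)).symm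
    rw [h, integral_fintype_prod_volume_eq_prod
      (fun i => (s i).indicator (gaussianPDFReal (m i) v)), ENNReal.ofReal_prod_of_nonneg]
    · refine Finset.prod_congr rfl fun i _ => ?_
      rw [integral_indicator (hs i), gaussianReal_apply_eq_integral _ hv]
    · exact fun i _ => integral_nonneg fun x =>
        Set.indicator_nonneg (fun _ _ => gaussianPDFReal_nonneg _ _ _) _
  · exact (Integrable.fintype_prod_dep fun i => integrable_gaussianPDFReal (m i) v).integrableOn
  · exact Filter.Eventually.of_forall fun y =>
      Finset.prod_nonneg fun i _ => gaussianPDFReal_nonneg _ _ _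

lemma map_add_isoGaussian (hv : v ≠ 0) (m : EuclideanSpace ℝ (Fin d)) :
    (isoGaussian d v).map (fun z => m + z) =
      volume.withDensity fun y => ENNReal.ofReal (isoPDF d v m y) := by
  have h1 : (isoGaussian d v).map (fun z => m + z) =
      (Measure.pi fun i => gaussianReal (m i) v).map (WithLp.toLp 2) := by
    have h : ∀ i, (gaussianReal 0 v).map (fun x => m i + x) = gaussianReal (m i) v := fun i => by
      rw [gaussianReal_map_const_add]; simp
    simp only [← h]
    rw [isoGaussian, Measure.map_map (by fun_prop) (by fun_prop),
      ← Measure.pi_map_pi (fun i => by fun_prop), Measure.map_map (by fun_prop) (by fun_prop)]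
    rfl
  rw [h1, pi_gaussianReal_eq_withDensity hv]
  ext A hA
  rw [Measure.map_apply (by fun_prop) hA, withDensity_apply _ hA,
    withDensity_apply _ ((WithLp.measurable_toLp 2 _) hA)]
  have := (PiLp.volume_preserving_toLp (Fin d)).setLIntegral_comp_preimage hA
    (f := fun y => ENNReal.ofReal (isoPDF d v m y))
    (measurable_isoPDF_comp measurable_const measurable_id).ennreal_ofReal
  exact this

/-- Completing the square: tilting a Gaussian by a power of a likelihood ratio gives a multiple of a
translated Gaussian. -/
lemma isoPDF_mul_rpow (hv : v ≠ 0) (a b y : EuclideanSpace ℝ (Fin d)) (l : ℝ) :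
    isoPDF d v a y * (isoPDF d v a y / isoPDF d v b y) ^ l =
      Real.exp (l * (l + 1) * (‖a - b‖ ^ 2 / v) / 2) * isoPDF d v (a + l • (a - b)) y := by
  have hv' : (v : ℝ) ≠ 0 := by exact_mod_cast hv
  have hZ : 0 < (√(2 * Real.pi * v))⁻¹ ^ d := by positivity
  simp only [isoPDF_eq]
  rw [mul_div_mul_left _ _ hZ.ne', ← Real.exp_sub, ← Real.exp_mul, mul_left_comm, mul_assoc,
    ← Real.exp_add, ← Real.exp_add]
  have e : y - (a + l • (a - b)) = (y - a) - l • (a - b) := by abel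
  have e2 : y - b = (y - a) + (a - b) := by abel
  rw [e, e2, norm_sub_sq_real (y - a), norm_add_sq_real (y - a), inner_smul_right, norm_smul, mul_pow,
    Real.norm_eq_abs, sq_abs]
  congr 2
  field_simp
  ring

/-- Completing the square for the cross terms of a `χ²` divergence: up to the factor `1 / v`, the
exponent is the inner product of `a - c` and `b - c`. -/
lemma isoPDF_mul_div (hv : v ≠ 0) (a b c y : EuclideanSpace ℝ (Fin d)) :
    isoPDF d v a y * isoPDF d v b y / isoPDF d v c y =
      Real.exp ((‖a - c‖ ^ 2 / v + ‖b - c‖ ^ 2 / v - ‖a - b‖ ^ 2 / v) / 2) *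
        isoPDF d v (a + b - c) y := by
  have hv' : (v : ℝ) ≠ 0 := by exact_mod_cast hv
  have hZ : (√(2 * Real.pi * v))⁻¹ ^ d ≠ 0 := by positivity
  simp only [isoPDF_eq]
  have e : ∀ Z A B C : ℝ, Z ≠ 0 → Z * Real.exp A * (Z * Real.exp B) / (Z * Real.exp C) =
      Z * Real.exp (A + B - C) := by
    intro Z A B C hZ
    rw [Real.exp_sub, Real.exp_add]; field_simp
  rw [e _ _ _ _ hZ, mul_left_comm, ← Real.exp_add]
  have e1 : y - (a + b - c) = (y - c) - ((a - c) + (b - c)) := by abel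
  have e2 : y - a = (y - c) - (a - c) := by abel
  have e3 : y - b = (y - c) - (b - c) := by abel
  have e4 : a - b = (a - c) - (b - c) := by abel
  rw [e1, e2, e3, e4]
  simp only [norm_sub_sq_real (y - c), norm_sub_sq_real (a - c), norm_add_sq_real, inner_add_right]
  congr 2
  field_simp
  ring

end SGLD

/-! ### Dominating densities and their composition -/

/-- Up to mass `δ`, the law `M` has a density `G` with respect to `M'`; that density is at most `c`
and its `p`-th moment under `M'` is at most `C`. -/
structure IsApproxDensity {Ω : Type*} [MeasurableSpace Ω] (M M' : Measure Ω) (G : Ω → ℝ≥0∞)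
    (p : ℝ) (c C δ : ℝ≥0∞) : Prop where
  measurable : Measurable G
  lintegral_le : ∀ f : Ω → ℝ≥0∞, Measurable f → (∀ ω, f ω ≤ 1) →
    ∫⁻ ω, f ω ∂M ≤ ∫⁻ ω, f ω * G ω ∂M' + δ
  le_bound : ∀ ω, G ω ≤ c
  moment_le : ∫⁻ ω, G ω ^ p ∂M' ≤ C

namespace IsApproxDensity

variable {α β : Type*} [MeasurableSpace α] [MeasurableSpace β]

lemma refl (M : Measure α) [IsProbabilityMeasure M] (p : ℝ) {c C : ℝ≥0∞} (δ : ℝ≥0∞)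
    (hc : 1 ≤ c) (hC : 1 ≤ C) : IsApproxDensity M M (fun _ => 1) p c C δ where
  measurable := measurable_const
  lintegral_le f _ _ := by simp
  le_bound _ := hc
  moment_le := by simpa using hC

lemma map {M M' : Measure α} {G : β → ℝ≥0∞} {e : α → β} {p : ℝ} {c C δ : ℝ≥0∞}
    (h : IsApproxDensity M M' (G ∘ e) p c C δ) (he : Measurable e) (hG : Measurable G)
    (hc : ∀ y, G y ≤ c) : IsApproxDensity (M.map e) (M'.map e) G p c C δ where
  measurable := hG
  lintegral_le f hf hf1 := by
    rw [lintegral_map hf he, lintegral_map (f := fun y => f y * G y) (hf.mul hG) he]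
    exact h.lintegral_le (f ∘ e) (hf.comp he) fun _ => hf1 _
  le_bound := hc
  moment_le := by
    rw [lintegral_map (hG.pow_const p) he]
    exact h.moment_le

/-- Sequential composition: densities multiply and the exceptional masses add up. -/
lemma compProd {μ ν : Measure α} [IsProbabilityMeasure μ] [IsProbabilityMeasure ν]
    {κ κ' : Kernel α β} [IsMarkovKernel κ] [IsMarkovKernel κ'] {G : α → ℝ≥0∞}
    {g : α × β → ℝ≥0∞} {p : ℝ} (hp : 0 ≤ p) {c₁ c₂ C₁ C₂ δ₁ δ₂ : ℝ≥0∞}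
    (hG : IsApproxDensity μ ν G p c₁ C₁ δ₁) (hgm : Measurable g)
    (hg : ∀ x, IsApproxDensity (κ x) (κ' x) (fun y => g (x, y)) p c₂ C₂ δ₂) :
    IsApproxDensity (μ ⊗ₘ κ) (ν ⊗ₘ κ') (fun z => G z.1 * g z) p (c₁ * c₂) (C₁ * C₂) (δ₁ + δ₂) where
  measurable := (hG.measurable.comp measurable_fst).mul hgm
  lintegral_le f hf hf1 := by
    have hH : Measurable fun z : α × β => G z.1 * g z := (hG.measurable.comp measurable_fst).mul hgm
    rw [Measure.lintegral_compProd hf, Measure.lintegral_compProd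
      (f := fun z => f z * (G z.1 * g z)) (hf.mul hH)]
    set h : α → ℝ≥0∞ := fun x => ∫⁻ y, f (x, y) * g (x, y) ∂κ' x with hh
    have hhm : Measurable h := (hf.mul hgm).lintegral_kernel_prod_right'
    -- truncating at `1` keeps the inner integral an admissible test function for `μ`
    have h1 : ∀ x, ∫⁻ y, f (x, y) ∂κ x ≤ min 1 (h x) + δ₂ := fun x => by
      rw [min_add]
      refine le_min ?_ ((hg x).lintegral_le _ (hf.comp measurable_prodMk_left) fun _ => hf1 _)
      calc ∫⁻ y, f (x, y) ∂κ x ≤ ∫⁻ _, 1 ∂κ x := lintegral_mono fun y => hf1 _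
        _ ≤ 1 + δ₂ := by simp
    calc ∫⁻ x, ∫⁻ y, f (x, y) ∂κ x ∂μ ≤ ∫⁻ x, (min 1 (h x) + δ₂) ∂μ := lintegral_mono h1
      _ = ∫⁻ x, min 1 (h x) ∂μ + δ₂ := by
        rw [lintegral_add_right _ measurable_const]; simp
      _ ≤ ∫⁻ x, min 1 (h x) * G x ∂ν + δ₁ + δ₂ := by
        gcongr
        exact hG.lintegral_le _ (measurable_const.min hhm) fun _ => min_le_left _ _
      _ ≤ ∫⁻ x, h x * G x ∂ν + δ₁ + δ₂ := by
        gcongr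
        exact min_le_right _ _
      _ = _ := by
        rw [add_assoc]
        congr 1
        refine lintegral_congr fun x => ?_
        rw [hh, ← lintegral_mul_const]
        · refine lintegral_congr fun y => ?_
          ring
        · exact (hf.mul hgm).comp measurable_prodMk_left
  le_bound z := mul_le_mul' (hG.le_bound _) ((hg z.1).le_bound z.2)
  moment_le := by
    have hH : Measurable fun z : α × β => G z.1 * g z := (hG.measurable.comp measurable_fst).mul hgm
    rw [Measure.lintegral_compProd (hH.pow_const p)]
    simp only [ENNReal.mul_rpow_of_nonneg _ _ hp]
    calc ∫⁻ x, ∫⁻ y, G x ^ p * g (x, y) ^ p ∂κ' x ∂ν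
        = ∫⁻ x, G x ^ p * ∫⁻ y, g (x, y) ^ p ∂κ' x ∂ν := by
          refine lintegral_congr fun x => ?_
          exact lintegral_const_mul _ ((hgm.comp measurable_prodMk_left).pow_const p)
      _ ≤ ∫⁻ x, G x ^ p * C₂ ∂ν := by
          gcongr with x
          exact (hg x).moment_le
      _ = (∫⁻ x, G x ^ p ∂ν) * C₂ := lintegral_mul_const _ (hG.measurable.pow_const p)
      _ ≤ C₁ * C₂ := by gcongr; exact hG.moment_le

lemma measure_le {M M' : Measure α} {G : α → ℝ≥0∞} {p : ℝ} {c C δ : ℝ≥0∞}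
    (h : IsApproxDensity M M' G p c C δ) {S : Set α} (hS : MeasurableSet S) :
    M S ≤ ∫⁻ ω in S, G ω ∂M' + δ := by
  have := h.lintegral_le (S.indicator 1) (measurable_one.indicator hS)
    fun ω => Set.indicator_le_self' (fun _ _ => zero_le_one) ω
  rw [lintegral_indicator_one hS] at this
  convert this using 2
  rw [← lintegral_indicator hS]
  refine lintegral_congr fun ω => ?_
  by_cases hω : ω ∈ S <;> simp [hω]

/-- A uniform bound on the density gives differential privacy. -/
lemma measure_le_of_bound {M M' : Measure α} {G : α → ℝ≥0∞} {p : ℝ} {c C δ : ℝ≥0∞}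
    (h : IsApproxDensity M M' G p c C δ) {S : Set α} (hS : MeasurableSet S) :
    M S ≤ c * M' S + δ := by
  refine (h.measure_le hS).trans ?_
  gcongr
  calc ∫⁻ ω in S, G ω ∂M' ≤ ∫⁻ _ in S, c ∂M' := lintegral_mono fun ω => h.le_bound ω
    _ = c * M' S := by simp

/-- A bound on the moment of order `1 + l` gives differential privacy, by Markov's inequality
applied to the part of the density above the threshold `w`. -/
lemma measure_le_of_moment {M M' : Measure α} {G : α → ℝ≥0∞} {l : ℝ} {c C δ : ℝ≥0∞} (hl : 0 < l)
    (h : IsApproxDensity M M' G (1 + l) c C δ) {w : ℝ≥0∞} (hw0 : w ≠ 0) (hw : w ≠ ∞)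
    (hc : c ≠ ∞)
    {S : Set α} (hS : MeasurableSet S) :
    M S ≤ w * M' S + (C * w ^ (-l) + δ) := by
  have key : ∀ ω, G ω ≤ w + G ω ^ (1 + l) * w ^ (-l) := by
    intro ω
    rcases le_total (G ω) w with hle | hle
    · exact hle.trans le_self_add
    · refine le_trans ?_ le_add_self
      have hG0 : G ω ≠ 0 := fun h0 => hw0 (le_bot_iff.1 (hle.trans_eq h0))
      have hGt : G ω ≠ ∞ := ((h.le_bound ω).trans_lt hc.lt_top).ne
      rw [ENNReal.rpow_add _ _ hG0 hGt, ENNReal.rpow_one, mul_assoc]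
      refine le_mul_of_one_le_right' ?_
      calc (1 : ℝ≥0∞) = w ^ l * w ^ (-l) := by
            rw [← ENNReal.rpow_add _ _ hw0 hw]; simp
        _ ≤ G ω ^ l * w ^ (-l) := by gcongr
  rw [← add_assoc]
  refine (h.measure_le hS).trans ?_
  gcongr
  calc ∫⁻ ω in S, G ω ∂M' ≤ ∫⁻ ω in S, (w + G ω ^ (1 + l) * w ^ (-l)) ∂M' := lintegral_mono key
    _ = w * M' S + (∫⁻ ω in S, G ω ^ (1 + l) ∂M') * w ^ (-l) := by
      rw [lintegral_add_left measurable_const, lintegral_mul_const _ (h.measurable.pow_const _)]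
      simp
    _ ≤ w * M' S + C * w ^ (-l) := by
      gcongr
      exact (setLIntegral_le_lintegral _ _).trans h.moment_le

end IsApproxDensity

/-! ### Privacy of a subsampled Gaussian mixture -/

namespace SGLD

variable {d : ℕ} {v : ℝ≥0}

lemma integral_isoPDF_mul_rpow_le (hv : v ≠ 0) {a b : EuclideanSpace ℝ (Fin d)} {l s : ℝ}
    (hl : 0 ≤ l) (h : ‖a - b‖ ^ 2 ≤ s * v) :
    ∫ y, isoPDF d v a y * (isoPDF d v a y / isoPDF d v b y) ^ l ≤
      Real.exp (l * (l + 1) * s / 2) := by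
  simp only [isoPDF_mul_rpow hv, integral_const_mul, integral_isoPDF hv, mul_one]
  have hv' : 0 < (v : ℝ) := by positivity
  have : ‖a - b‖ ^ 2 / v ≤ s := (div_le_iff₀ hv').2 h
  gcongr

lemma integrable_isoPDF_mul_rpow (hv : v ≠ 0) (a b : EuclideanSpace ℝ (Fin d)) (l : ℝ) :
    Integrable fun y => isoPDF d v a y * (isoPDF d v a y / isoPDF d v b y) ^ l := by
  simp only [isoPDF_mul_rpow hv]
  exact (integrable_isoPDF _).const_mul _

lemma sq_isoPDF_sub_div_eq (a b c y : EuclideanSpace ℝ (Fin d)) :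
    (isoPDF d v a y - isoPDF d v b y) ^ 2 / isoPDF d v c y =
      isoPDF d v a y * isoPDF d v a y / isoPDF d v c y +
        isoPDF d v b y * isoPDF d v b y / isoPDF d v c y -
        2 * (isoPDF d v a y * isoPDF d v b y / isoPDF d v c y) := by
  ring

lemma integrable_sq_isoPDF_sub_div (hv : v ≠ 0) (a b c : EuclideanSpace ℝ (Fin d)) :
    Integrable fun y => (isoPDF d v a y - isoPDF d v b y) ^ 2 / isoPDF d v c y := by
  simp only [sq_isoPDF_sub_div_eq, isoPDF_mul_div hv]
  exact (((integrable_isoPDF _).const_mul _).add ((integrable_isoPDF _).const_mul _)).sub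
    (((integrable_isoPDF _).const_mul _).const_mul _)

/-- A three-point `χ²` bound for Gaussians whose means are pairwise close. -/
lemma integral_sq_isoPDF_sub_div_le (hv : v ≠ 0) {a b c : EuclideanSpace ℝ (Fin d)} {s : ℝ}
    (hab : ‖a - b‖ ^ 2 ≤ s * v) (hac : ‖a - c‖ ^ 2 ≤ s * v) (hbc : ‖b - c‖ ^ 2 ≤ s * v) :
    ∫ y, (isoPDF d v a y - isoPDF d v b y) ^ 2 / isoPDF d v c y ≤ s * Real.exp s := by
  have hv' : 0 < (v : ℝ) := by positivity
  simp only [sq_isoPDF_sub_div_eq, isoPDF_mul_div hv]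
  rw [integral_sub, integral_add, integral_const_mul, integral_const_mul, integral_const_mul,
    integral_const_mul, integral_isoPDF hv, integral_isoPDF hv, integral_isoPDF hv]
  · refine le_trans (le_of_eq ?_) (exp_add_exp_sub_two_mul_exp_le
      (A := ‖a - c‖ ^ 2 / v) (B := ‖b - c‖ ^ 2 / v) (D := ‖a - b‖ ^ 2 / v)
      (by positivity) (by positivity)
      ((div_le_iff₀ hv').2 hac) ((div_le_iff₀ hv').2 hbc) ((div_le_iff₀ hv').2 hab))
    simp
  · exact (integrable_isoPDF _).const_mul _
  · exact (integrable_isoPDF _).const_mul _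
  · exact ((integrable_isoPDF _).const_mul _).add ((integrable_isoPDF _).const_mul _)
  · exact ((integrable_isoPDF _).const_mul _).const_mul _

/-- Second order bound for the power of a ratio cut off at `1 + q c`. The cut-off keeps the exponent
in `g ^ p ≤ exp (p (g - 1))` within the range of `exp_le_one_add_add_sq`. -/
lemma rpow_min_le {r q c p : ℝ} (hr : 0 ≤ r) (hc : 0 ≤ q * c) (hp : 0 ≤ p)
    (hpc : p * (q * c) ≤ 17 / 10) :
    min r (1 + q * c) ^ p ≤ 1 + p * (r - 1) + p ^ 2 * (r - 1) ^ 2 := by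
  set g := min r (1 + q * c) with hg
  have hg0 : 0 ≤ g := le_min hr (by linarith)
  have hgc : g ≤ 1 + q * c := min_le_right _ _
  have hgr : g ≤ r := min_le_left _ _
  have h1 : g ^ p ≤ Real.exp (p * (g - 1)) := by
    rw [mul_comm, Real.exp_mul]
    exact Real.rpow_le_rpow hg0 (by linarith [Real.add_one_le_exp (g - 1)]) hp
  have h2 := exp_le_one_add_add_sq (x := p * (g - 1))
    ((mul_le_mul_of_nonneg_left (by linarith) hp).trans hpc)
  have h3 : (g - 1) ^ 2 ≤ (r - 1) ^ 2 := by
    rcases min_cases r (1 + q * c) with ⟨h, _⟩ | ⟨h, h'⟩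
    · rw [hg, h]
    · rw [hg, h]
      gcongr
      linarith
  nlinarith [mul_le_mul_of_nonneg_left hgr hp, mul_le_mul_of_nonneg_left h3 (sq_nonneg p)]

/-- If a Gaussian mixture is perturbed by moving a fraction `q` of its mass, with all the means
involved at squared distance at most `s v` from one another, then the density ratio cut off at
`1 + q (e^t - 1)` is an approximate density. The lost mass is a Chernoff bound at the exponent `l`,
the moment is controlled by the `χ²` divergence. Each triple `(a i, b i, c i)` describes mass moved
from mean `b i` to mean `a i` inside a component which also contains the mean `c i`. -/
lemma isApproxDensity_mixture {ι : Type*} {I : Finset ι} (hI : I.Nonempty)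
    {a b c : ι → EuclideanSpace ℝ (Fin d)} {pX pY : EuclideanSpace ℝ (Fin d) → ℝ}
    {q s t l p : ℝ} (hv : v ≠ 0) (hq : 0 ≤ q) (ht : 0 ≤ t) (hl : 1 ≤ l) (hp : 0 ≤ p)
    (hpc : p * (q * (Real.exp t - 1)) ≤ 17 / 10)
    (hX0 : ∀ y, 0 ≤ pX y)
    (hY : ∀ y, pY y = (I.card : ℝ)⁻¹ * ∑ i ∈ I, isoPDF d v (c i) y)
    (hX : ∀ y, pX y = pY y +
      q * ((I.card : ℝ)⁻¹ * ∑ i ∈ I, (isoPDF d v (a i) y - isoPDF d v (b i) y)))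
    (hab : ∀ i ∈ I, ‖a i - b i‖ ^ 2 ≤ s * v) (hac : ∀ i ∈ I, ‖a i - c i‖ ^ 2 ≤ s * v)
    (hbc : ∀ i ∈ I, ‖b i - c i‖ ^ 2 ≤ s * v) :
    IsApproxDensity (volume.withDensity fun y => ENNReal.ofReal (pX y))
      (volume.withDensity fun y => ENNReal.ofReal (pY y))
      (fun y => ENNReal.ofReal (min (pX y / pY y) (1 + q * (Real.exp t - 1)))) p
      (ENNReal.ofReal (1 + q * (Real.exp t - 1)))
      (ENNReal.ofReal (1 + p ^ 2 * (q ^ 2 * (s * Real.exp s))))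
      (ENNReal.ofReal (q * (2⁻¹ * Real.exp (l * (l + 1) * s / 2 - l * t)))) := by
  have hm : (0 : ℝ) < I.card := by exact_mod_cast hI.card_pos
  have hY0 : ∀ y, 0 < pY y := fun y => by
    rw [hY]
    exact mul_pos (inv_pos.2 hm) (Finset.sum_pos (fun i _ => isoPDF_pos hv _ _) hI)
  have hYm : Measurable pY := by
    rw [funext hY]
    exact (Finset.measurable_sum _ fun i _ =>
      measurable_isoPDF_comp measurable_const measurable_id).const_mul _
  have hXm : Measurable pX := by
    rw [funext hX]
    exact hYm.add (((Finset.measurable_sum _ fun i _ =>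
      (measurable_isoPDF_comp measurable_const measurable_id).sub
        (measurable_isoPDF_comp measurable_const measurable_id)).const_mul _).const_mul _)
  have hYi : Integrable pY := by
    rw [funext hY]
    exact (integrable_finsetSum _ fun i _ => integrable_isoPDF _).const_mul _
  have hYint : ∫ y, pY y = 1 := by
    simp only [hY]
    rw [integral_const_mul, integral_finsetSum _ fun i _ => integrable_isoPDF _]
    simp [integral_isoPDF hv, hm.ne']
  have hD : ∀ i ∈ I, Integrable fun y => isoPDF d v (a i) y - isoPDF d v (b i) y :=
    fun i _ => (integrable_isoPDF _).sub (integrable_isoPDF _)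
  have hDi : Integrable fun y => ∑ i ∈ I, (isoPDF d v (a i) y - isoPDF d v (b i) y) :=
    integrable_finsetSum _ hD
  have hDint : ∫ y, ∑ i ∈ I, (isoPDF d v (a i) y - isoPDF d v (b i) y) = 0 := by
    rw [integral_finsetSum _ hD]
    refine Finset.sum_eq_zero fun i _ => ?_
    rw [integral_sub (integrable_isoPDF _) (integrable_isoPDF _), integral_isoPDF hv,
      integral_isoPDF hv, sub_self]
  have hc0 : 0 ≤ Real.exp t - 1 := by linarith [Real.add_one_le_exp t]
  have hqc : 0 ≤ q * (Real.exp t - 1) := mul_nonneg hq hc0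
  have hgm : Measurable fun y => ENNReal.ofReal (min (pX y / pY y) (1 + q * (Real.exp t - 1))) :=
    ((hXm.div hYm).min measurable_const).ennreal_ofReal
  have hg0 : ∀ y, 0 ≤ min (pX y / pY y) (1 + q * (Real.exp t - 1)) := fun y =>
    le_min (div_nonneg (hX0 y) (hY0 y).le) (by linarith)
  refine ⟨hgm, fun f hf hf1 => ?_, fun y => ENNReal.ofReal_le_ofReal (min_le_right _ _), ?_⟩
  · set h : ι → EuclideanSpace ℝ (Fin d) → ℝ := fun i y =>
      isoPDF d v (a i) y * (isoPDF d v (a i) y / isoPDF d v (b i) y) ^ l +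
        isoPDF d v (a i) y * (isoPDF d v (a i) y / isoPDF d v (c i) y) ^ l with hh
    set H : EuclideanSpace ℝ (Fin d) → ℝ := fun y =>
      q * ((I.card : ℝ)⁻¹ * ∑ i ∈ I, 4⁻¹ * Real.exp (-(l * t)) * h i y) with hHdef
    have hh0 : ∀ i y, 0 ≤ h i y := fun i y => by
      have h1 := isoPDF_pos hv (a i) y
      have h2 := isoPDF_pos hv (b i) y
      have h3 := isoPDF_pos hv (c i) y
      positivity
    have hH0 : ∀ y, 0 ≤ H y := fun y =>
      mul_nonneg hq (mul_nonneg (inv_nonneg.2 hm.le) (Finset.sum_nonneg fun i _ =>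
        mul_nonneg (by positivity) (hh0 i y)))
    have hhi : ∀ i, Integrable (h i) := fun i =>
      (integrable_isoPDF_mul_rpow hv _ _ l).add (integrable_isoPDF_mul_rpow hv _ _ l)
    have hHi : Integrable H :=
      ((integrable_finsetSum _ fun i _ => (hhi i).const_mul _).const_mul _).const_mul _
    have hhint : ∀ i ∈ I, ∫ y, h i y ≤ 2 * Real.exp (l * (l + 1) * s / 2) := fun i hi => by
      rw [hh, integral_add (integrable_isoPDF_mul_rpow hv _ _ l)
        (integrable_isoPDF_mul_rpow hv _ _ l), two_mul]
      exact add_le_add (integral_isoPDF_mul_rpow_le hv (by linarith) (hab i hi))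
        (integral_isoPDF_mul_rpow_le hv (by linarith) (hac i hi))
    have hHint : ∫ y, H y ≤ q * (2⁻¹ * Real.exp (l * (l + 1) * s / 2 - l * t)) := by
      rw [hHdef, integral_const_mul, integral_const_mul,
        integral_finsetSum _ fun i _ => (hhi i).const_mul _]
      refine mul_le_mul_of_nonneg_left ?_ hq
      rw [inv_mul_le_iff₀ hm, ← nsmul_eq_mul]
      refine Finset.sum_le_card_nsmul _ _ _ fun i hi => ?_
      rw [integral_const_mul]
      refine (mul_le_mul_of_nonneg_left (hhint i hi) (by positivity)).trans (le_of_eq ?_)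
      rw [sub_eq_add_neg, Real.exp_add]; ring
    -- mass of `pX` above the cut-off
    have hpt : ∀ y, pX y ≤ min (pX y / pY y) (1 + q * (Real.exp t - 1)) * pY y + H y := by
      intro y
      have hexcess : pX y - (1 + q * (Real.exp t - 1)) * pY y ≤ H y := by
        have e : pX y - (1 + q * (Real.exp t - 1)) * pY y = q * ((I.card : ℝ)⁻¹ * ∑ i ∈ I,
            (isoPDF d v (a i) y - isoPDF d v (b i) y -
              (Real.exp t - 1) * isoPDF d v (c i) y)) := by
          simp only [hX, Finset.sum_sub_distrib, ← Finset.mul_sum, hY]; ring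
        rw [e, hHdef]
        refine mul_le_mul_of_nonneg_left (mul_le_mul_of_nonneg_left ?_ (inv_nonneg.2 hm.le)) hq
        exact Finset.sum_le_sum fun i _ => sub_sub_le_rpow (isoPDF_pos hv _ _)
          (isoPDF_pos hv _ _) (isoPDF_pos hv _ _) ht hl
      rw [min_mul_of_nonneg _ _ (hY0 y).le, div_mul_cancel₀ _ (hY0 y).ne', min_add]
      exact le_min (by linarith [hH0 y]) (by linarith)
    rw [lintegral_withDensity_eq_lintegral_mul _ hXm.ennreal_ofReal hf,
      lintegral_withDensity_eq_lintegral_mul _ hYm.ennreal_ofReal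
        (g := fun y => f y * ENNReal.ofReal (min (pX y / pY y) (1 + q * (Real.exp t - 1))))
        (hf.mul hgm)]
    calc ∫⁻ y, ENNReal.ofReal (pX y) * f y
        ≤ ∫⁻ y, (ENNReal.ofReal (pY y) * (f y *
            ENNReal.ofReal (min (pX y / pY y) (1 + q * (Real.exp t - 1)))) +
            ENNReal.ofReal (H y)) := by
          refine lintegral_mono fun y => ?_
          calc ENNReal.ofReal (pX y) * f y
              ≤ (ENNReal.ofReal (min (pX y / pY y) (1 + q * (Real.exp t - 1))) *
                ENNReal.ofReal (pY y) + ENNReal.ofReal (H y)) * f y := by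
                gcongr
                rw [← ENNReal.ofReal_mul (hg0 y),
                  ← ENNReal.ofReal_add (mul_nonneg (hg0 y) (hY0 y).le) (hH0 y)]
                exact ENNReal.ofReal_le_ofReal (hpt y)
            _ ≤ _ := by
                rw [add_mul]
                exact add_le_add (le_of_eq (by ring)) (mul_le_of_le_one_right' (hf1 y))
      _ = _ + ∫⁻ y, ENNReal.ofReal (H y) :=
          lintegral_add_left (hYm.ennreal_ofReal.mul (hf.mul hgm)) _
      _ ≤ _ := by
          gcongr
          · exact le_rfl
          · rw [← ofReal_integral_eq_lintegral_ofReal hHi (Filter.Eventually.of_forall hH0)]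
            exact ENNReal.ofReal_le_ofReal hHint
  · set R : EuclideanSpace ℝ (Fin d) → ℝ := fun y =>
      pY y + p * (q * ((I.card : ℝ)⁻¹ * ∑ i ∈ I, (isoPDF d v (a i) y - isoPDF d v (b i) y))) +
        p ^ 2 * (q ^ 2 * ((I.card : ℝ)⁻¹ * ∑ i ∈ I,
          (isoPDF d v (a i) y - isoPDF d v (b i) y) ^ 2 / isoPDF d v (c i) y)) with hR
    have hSi : Integrable fun y => ∑ i ∈ I,
        (isoPDF d v (a i) y - isoPDF d v (b i) y) ^ 2 / isoPDF d v (c i) y :=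
      integrable_finsetSum _ fun i _ => integrable_sq_isoPDF_sub_div hv _ _ _
    have hpt : ∀ y, min (pX y / pY y) (1 + q * (Real.exp t - 1)) ^ p * pY y ≤ R y := by
      intro y
      have h1 := rpow_min_le (div_nonneg (hX0 y) (hY0 y).le) hqc hp hpc
      refine (mul_le_mul_of_nonneg_right h1 (hY0 y).le).trans ?_
      have e1 : pX y / pY y - 1 = (pX y - pY y) / pY y := by
        rw [sub_div, div_self (hY0 y).ne']
      have e2 : pX y - pY y =
          q * ((I.card : ℝ)⁻¹ * ∑ i ∈ I, (isoPDF d v (a i) y - isoPDF d v (b i) y)) := by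
        rw [hX]; ring
      -- joint convexity of `(u, w) ↦ u² / w`
      have h2 : (pX y - pY y) ^ 2 / pY y ≤ q ^ 2 * ((I.card : ℝ)⁻¹ * ∑ i ∈ I,
          (isoPDF d v (a i) y - isoPDF d v (b i) y) ^ 2 / isoPDF d v (c i) y) := by
        have h3 := Finset.sq_sum_div_le_sum_sq_div I
          (fun i => isoPDF d v (a i) y - isoPDF d v (b i) y)
          (fun i _ => isoPDF_pos hv (c i) y)
        have hS : 0 < ∑ i ∈ I, isoPDF d v (c i) y :=
          Finset.sum_pos (fun i _ => isoPDF_pos hv _ _) hI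
        calc (pX y - pY y) ^ 2 / pY y = q ^ 2 * ((I.card : ℝ)⁻¹ *
              ((∑ i ∈ I, (isoPDF d v (a i) y - isoPDF d v (b i) y)) ^ 2 /
                ∑ i ∈ I, isoPDF d v (c i) y)) := by
              rw [e2, hY]; field_simp
          _ ≤ _ := by gcongr
      have e3 : (1 + p * (pX y / pY y - 1) + p ^ 2 * (pX y / pY y - 1) ^ 2) * pY y =
          pY y + p * (pX y - pY y) + p ^ 2 * ((pX y - pY y) ^ 2 / pY y) := by
        rw [e1]
        have := (hY0 y).ne'
        field_simp
      rw [e2] at h2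
      rw [e3, e2]
      exact add_le_add le_rfl (mul_le_mul_of_nonneg_left h2 (sq_nonneg p))
    have hR0 : ∀ y, 0 ≤ R y := fun y =>
      (mul_nonneg (Real.rpow_nonneg (hg0 y) p) (hY0 y).le).trans (hpt y)
    have hDi' : Integrable fun y => p * (q * ((I.card : ℝ)⁻¹ *
        ∑ i ∈ I, (isoPDF d v (a i) y - isoPDF d v (b i) y))) :=
      ((hDi.const_mul _).const_mul _).const_mul _
    have hYDi : Integrable fun y => pY y + p * (q * ((I.card : ℝ)⁻¹ *
        ∑ i ∈ I, (isoPDF d v (a i) y - isoPDF d v (b i) y))) := hYi.add hDi'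
    have hSi' : Integrable fun y => p ^ 2 * (q ^ 2 * ((I.card : ℝ)⁻¹ * ∑ i ∈ I,
        (isoPDF d v (a i) y - isoPDF d v (b i) y) ^ 2 / isoPDF d v (c i) y)) :=
      ((hSi.const_mul _).const_mul _).const_mul _
    have hRi : Integrable R := hYDi.add hSi'
    have hRint : ∫ y, R y ≤ 1 + p ^ 2 * (q ^ 2 * (s * Real.exp s)) := by
      rw [hR, integral_add hYDi hSi', integral_add hYi hDi']
      simp only [integral_const_mul]
      rw [hDint, hYint, mul_zero, mul_zero, mul_zero, add_zero,
        integral_finsetSum _ fun i _ => integrable_sq_isoPDF_sub_div hv _ _ _]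
      refine add_le_add le_rfl (mul_le_mul_of_nonneg_left
        (mul_le_mul_of_nonneg_left ?_ (sq_nonneg q)) (sq_nonneg p))
      rw [inv_mul_le_iff₀ hm, ← nsmul_eq_mul]
      exact Finset.sum_le_card_nsmul _ _ _ fun i hi =>
        integral_sq_isoPDF_sub_div_le hv (hab i hi) (hac i hi) (hbc i hi)
    rw [lintegral_withDensity_eq_lintegral_mul _ hYm.ennreal_ofReal (hgm.pow_const p)]
    calc ∫⁻ y, ENNReal.ofReal (pY y) *
          ENNReal.ofReal (min (pX y / pY y) (1 + q * (Real.exp t - 1))) ^ p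
        ≤ ∫⁻ y, ENNReal.ofReal (R y) := by
          refine lintegral_mono fun y => ?_
          rw [ENNReal.ofReal_rpow_of_nonneg (hg0 y) hp, ← ENNReal.ofReal_mul (hY0 y).le, mul_comm]
          exact ENNReal.ofReal_le_ofReal (hpt y)
      _ = ENNReal.ofReal (∫ y, R y) :=
          (ofReal_integral_eq_lintegral_ofReal hRi (Filter.Eventually.of_forall hR0)).symm
      _ ≤ _ := ENNReal.ofReal_le_ofReal hRint

end SGLD

/-! ### Minibatches containing a given index -/

namespace SGLD

/-- For a minibatch `S` containing `j`, replace `j` by `i`, unless `i` already belongs to `S`. -/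
def swapIn {N : ℕ} (j : Fin N) (S : Finset (Fin N)) (i : Fin N) : Finset (Fin N) :=
  if i ∈ S then S else insert i (S.erase j)

/-- The pairs of a minibatch of size `τ` containing `j` and an index. -/
def swapPairs {N : ℕ} (τ : ℕ) (j : Fin N) : Finset (Finset (Fin N) × Fin N) :=
  (Finset.powersetCard τ Finset.univ).filter (j ∈ ·) ×ˢ Finset.univ

/-- Replacing `j` by a uniformly random index in a uniformly random minibatch containing `j` gives a
uniformly random minibatch. -/
lemma sum_swapPairs {N : ℕ} (τ : ℕ) (j : Fin N) (F : Finset (Fin N) → ℝ) :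
    ∑ x ∈ swapPairs τ j, F (swapIn j x.1 x.2) =
      τ * ∑ S ∈ Finset.powersetCard τ Finset.univ, F S := by
  set P := Finset.powersetCard τ (Finset.univ : Finset (Fin N))
  have hcard : ∀ S ∈ P, S.card = τ := fun S hS => (Finset.mem_powersetCard.1 hS).2
  have hin : ∀ S ∈ P, ∑ i ∈ S, F S = τ * F S := fun S hS => by
    rw [Finset.sum_const, hcard S hS, nsmul_eq_mul]
  have hbij : ∑ S ∈ P.filter (j ∈ ·), ∑ i ∈ Sᶜ, F (insert i (S.erase j)) =
      ∑ S ∈ P.filter (j ∉ ·), ∑ i ∈ S, F S := by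
    rw [Finset.sum_sigma', Finset.sum_sigma']
    refine Finset.sum_bij' (fun x _ => ⟨insert x.2 (x.1.erase j), x.2⟩)
      (fun x _ => ⟨insert j (x.1.erase x.2), x.2⟩) ?_ ?_ ?_ ?_ ?_
    · rintro ⟨S, i⟩ h
      simp only [Finset.mem_sigma, Finset.mem_filter, Finset.mem_compl, P,
        Finset.mem_powersetCard_univ] at h ⊢
      obtain ⟨⟨h1, h2⟩, h3⟩ := h
      have hne : j ≠ i := by rintro rfl; exact h3 h2
      refine ⟨⟨?_, by simp [hne]⟩, by simp⟩
      rw [Finset.card_insert_of_notMem (by simp [h3]), Finset.card_erase_add_one h2, h1]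
    · rintro ⟨S, i⟩ h
      simp only [Finset.mem_sigma, Finset.mem_filter, Finset.mem_compl, P,
        Finset.mem_powersetCard_univ] at h ⊢
      obtain ⟨⟨h1, h2⟩, h3⟩ := h
      have hne : i ≠ j := by rintro rfl; exact h2 h3
      refine ⟨⟨?_, by simp⟩, by simp [hne]⟩
      rw [Finset.card_insert_of_notMem (by simp [h2]), Finset.card_erase_add_one h3, h1]
    · rintro ⟨S, i⟩ h
      simp only [Finset.mem_sigma, Finset.mem_filter, Finset.mem_compl] at h
      simp only [Sigma.mk.injEq, heq_eq_eq, and_true]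
      rw [Finset.erase_insert (by simp [h.2]), Finset.insert_erase h.1.2]
    · rintro ⟨S, i⟩ h
      simp only [Finset.mem_sigma, Finset.mem_filter] at h
      simp only [Sigma.mk.injEq, heq_eq_eq, and_true]
      rw [Finset.erase_insert (by simp [h.1.2]), Finset.insert_erase h.2]
    · rintro ⟨S, i⟩ h
      rfl
  rw [swapPairs, Finset.sum_product, Finset.mul_sum,
    ← Finset.sum_filter_add_sum_filter_not P (j ∈ ·) (fun S => (τ : ℝ) * F S),
    ← Finset.sum_congr rfl fun S hS => hin S (Finset.mem_filter.1 hS).1,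
    ← Finset.sum_congr rfl fun S hS => hin S (Finset.mem_filter.1 hS).1,
    ← hbij, ← Finset.sum_add_distrib]
  refine Finset.sum_congr rfl fun S _ => ?_
  rw [← Finset.sum_add_sum_compl S]
  congr 1
  · exact Finset.sum_congr rfl fun i hi => by simp [swapIn, hi]
  · exact Finset.sum_congr rfl fun i hi => by simp [swapIn, Finset.mem_compl.1 hi]

lemma card_swapPairs {N : ℕ} (τ : ℕ) (j : Fin N) :
    ((swapPairs τ j).card : ℝ) = τ * (N.choose τ : ℝ) := by
  simpa using sum_swapPairs τ j fun _ => 1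

lemma sum_swapPairs_fst {N : ℕ} (τ : ℕ) (j : Fin N) (D : Finset (Fin N) → ℝ)
    (hD : ∀ S, j ∉ S → D S = 0) :
    ∑ x ∈ swapPairs τ j, D x.1 = N * ∑ S ∈ Finset.powersetCard τ Finset.univ, D S := by
  rw [swapPairs, Finset.sum_product, Finset.mul_sum, Finset.sum_filter]
  refine Finset.sum_congr rfl fun S _ => ?_
  split_ifs with h
  · simp
  · simp [hD S h]

/-! ### Sensitivity of the updates -/

variable {𝒳 : Type*} {d N : ℕ}

lemma norm_gradient_le {f : EuclideanSpace ℝ (Fin d) → ℝ} {L : ℝ≥0} (hf : LipschitzWith L f)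
    (θ : EuclideanSpace ℝ (Fin d)) : ‖gradient f θ‖ ≤ L := by
  rw [gradient, LinearIsometryEquiv.norm_map]
  exact norm_fderiv_le_of_lipschitz ℝ hf

/-- Exchanging one gradient in the minibatch moves the update by at most `2 η (N / τ) L`. -/
lemma norm_gradStep_sub_le {ℓ : 𝒳 → EuclideanSpace ℝ (Fin d) → ℝ}
    (r : EuclideanSpace ℝ (Fin d) → ℝ) {L : ℝ≥0} (hL : ∀ x, LipschitzWith L (ℓ x)) (τ : ℕ) {η : ℝ}
    (hη : 0 ≤ η) {X Y : Fin N → 𝒳} {R : Finset (Fin N)} {i j : Fin N} (hj : j ∉ R) (hi : i ∉ R)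
    (hXY : ∀ k ∈ R, X k = Y k) (θ : EuclideanSpace ℝ (Fin d)) :
    ‖gradStep ℓ r τ η X (insert j R) θ - gradStep ℓ r τ η Y (insert i R) θ‖ ≤
      2 * η * (N / τ) * L := by
  have hR : ∑ k ∈ R, gradient (ℓ (X k)) θ = ∑ k ∈ R, gradient (ℓ (Y k)) θ :=
    Finset.sum_congr rfl fun k hk => by rw [hXY k hk]
  have e : gradStep ℓ r τ η X (insert j R) θ - gradStep ℓ r τ η Y (insert i R) θ =
      (η * (N / τ)) • (gradient (ℓ (Y i)) θ - gradient (ℓ (X j)) θ) := by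
    rw [gradStep, gradStep, Finset.sum_insert hj, Finset.sum_insert hi, hR]
    module
  rw [e, norm_smul, Real.norm_of_nonneg (by positivity)]
  calc η * (N / τ) * ‖gradient (ℓ (Y i)) θ - gradient (ℓ (X j)) θ‖
      ≤ η * (N / τ) * (L + L) := by
        gcongr
        exact (norm_sub_le _ _).trans
          (add_le_add (norm_gradient_le (hL _) _) (norm_gradient_le (hL _) _))
    _ = _ := by ring

lemma gradStep_congr (ℓ : 𝒳 → EuclideanSpace ℝ (Fin d) → ℝ) (r : EuclideanSpace ℝ (Fin d) → ℝ)
    (τ : ℕ) (η : ℝ) {X Y : Fin N → 𝒳} {S : Finset (Fin N)} (h : ∀ k ∈ S, X k = Y k)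
    (θ : EuclideanSpace ℝ (Fin d)) :
    gradStep ℓ r τ η X S θ = gradStep ℓ r τ η Y S θ := by
  have : ∑ k ∈ S, gradient (ℓ (X k)) θ = ∑ k ∈ S, gradient (ℓ (Y k)) θ :=
    Finset.sum_congr rfl fun k hk => by rw [h k hk]
  rw [gradStep, gradStep, this]

/-- The Lebesgue density of the transition kernel of one update. -/
noncomputable def stepPDF (ℓ : 𝒳 → EuclideanSpace ℝ (Fin d) → ℝ) (r : EuclideanSpace ℝ (Fin d) → ℝ)
    (τ : ℕ) (η : ℝ) (v : ℝ≥0) (X : Fin N → 𝒳) (θ y : EuclideanSpace ℝ (Fin d)) : ℝ :=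
  (N.choose τ : ℝ)⁻¹ * ∑ S ∈ Finset.powersetCard τ (Finset.univ : Finset (Fin N)),
    isoPDF d v (gradStep ℓ r τ η X S θ) y

lemma isoPDF_nonneg (v : ℝ≥0) (m y : EuclideanSpace ℝ (Fin d)) : 0 ≤ isoPDF d v m y :=
  Finset.prod_nonneg fun _ _ => gaussianPDFReal_nonneg _ _ _

lemma stepPDF_nonneg (ℓ : 𝒳 → EuclideanSpace ℝ (Fin d) → ℝ) (r : EuclideanSpace ℝ (Fin d) → ℝ)
    (τ : ℕ) (η : ℝ) (v : ℝ≥0) (X : Fin N → 𝒳) (θ y : EuclideanSpace ℝ (Fin d)) :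
    0 ≤ stepPDF ℓ r τ η v X θ y :=
  mul_nonneg (by positivity) (Finset.sum_nonneg fun _ _ => isoPDF_nonneg _ _ _)

lemma measurable_stepPDF (ℓ : 𝒳 → EuclideanSpace ℝ (Fin d) → ℝ)
    (r : EuclideanSpace ℝ (Fin d) → ℝ) (τ : ℕ) (η : ℝ) (v : ℝ≥0) (X : Fin N → 𝒳) :
    Measurable fun p : EuclideanSpace ℝ (Fin d) × EuclideanSpace ℝ (Fin d) =>
      stepPDF ℓ r τ η v X p.1 p.2 :=
  (Finset.measurable_sum _ fun S _ => measurable_isoPDF_comp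
    ((measurable_gradStep ℓ r τ η X S).comp measurable_fst) measurable_snd).const_mul _

lemma stepKernel_eq_withDensity (ℓ : 𝒳 → EuclideanSpace ℝ (Fin d) → ℝ)
    (r : EuclideanSpace ℝ (Fin d) → ℝ) {τ : ℕ} (hτ : τ ≤ N) (η : ℝ) {v : ℝ≥0} (hv : v ≠ 0)
    (X : Fin N → 𝒳) (θ : EuclideanSpace ℝ (Fin d)) :
    stepKernel ℓ r τ η v X θ =
      volume.withDensity fun y => ENNReal.ofReal (stepPDF ℓ r τ η v X θ y) := by
  have hC : (0 : ℝ) < N.choose τ := by exact_mod_cast Nat.choose_pos hτ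
  ext A hA
  simp only [stepKernel, Kernel.coe_mk, Measure.smul_apply, Measure.finsetSum_apply,
    map_add_isoGaussian hv, withDensity_apply _ hA, smul_eq_mul]
  have hm : ∀ S : Finset (Fin N), Measurable fun y =>
      ENNReal.ofReal (isoPDF d v (gradStep ℓ r τ η X S θ) y) := fun S =>
    (measurable_isoPDF_comp measurable_const measurable_id).ennreal_ofReal
  rw [← lintegral_finsetSum _ fun S _ => hm S,
    ← lintegral_const_mul _ (Finset.measurable_fun_sum _ fun S _ => hm S)]
  refine lintegral_congr fun y => ?_
  rw [stepPDF, ENNReal.ofReal_mul (inv_nonneg.2 hC.le), ENNReal.ofReal_inv_of_pos hC,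
    ENNReal.ofReal_natCast, ENNReal.ofReal_sum_of_nonneg fun _ _ => isoPDF_nonneg _ _ _]

/-- One update, for data sets that differ at the index `j` only. The parameter `s` bounds the squared
sensitivity relative to the noise variance; the variance may vanish. -/
lemma exists_isApproxDensity_stepKernel {τ : ℕ} (hτ : 1 ≤ τ) (hτN : τ ≤ N)
    {ℓ : 𝒳 → EuclideanSpace ℝ (Fin d) → ℝ} (r : EuclideanSpace ℝ (Fin d) → ℝ) {L : ℝ≥0}
    (hL : ∀ x, LipschitzWith L (ℓ x)) {η : ℝ} (hη : 0 ≤ η) {v : ℝ≥0} {X Y : Fin N → 𝒳} {j : Fin N}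
    (hXY : ∀ k, k ≠ j → X k = Y k) {s t l p : ℝ} (hs0 : 0 ≤ s)
    (hs : (2 * η * (N / τ) * L) ^ 2 ≤ s * v)
    (ht : 0 ≤ t) (hl : 1 ≤ l) (hp : 0 ≤ p) (hpc : p * ((τ / N : ℝ) * (Real.exp t - 1)) ≤ 17 / 10) :
    ∃ g : EuclideanSpace ℝ (Fin d) × EuclideanSpace ℝ (Fin d) → ℝ≥0∞, Measurable g ∧
      ∀ θ, IsApproxDensity (stepKernel ℓ r τ η v X θ) (stepKernel ℓ r τ η v Y θ)
        (fun y => g (θ, y)) p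
        (ENNReal.ofReal (1 + (τ / N : ℝ) * (Real.exp t - 1)))
        (ENNReal.ofReal (1 + p ^ 2 * ((τ / N : ℝ) ^ 2 * (s * Real.exp s))))
        (ENNReal.ofReal ((τ / N : ℝ) * (2⁻¹ * Real.exp (l * (l + 1) * s / 2 - l * t)))) := by
  have hc0 : 0 ≤ Real.exp t - 1 := by linarith [Real.add_one_le_exp t]
  have hXS : ∀ S : Finset (Fin N), j ∉ S → ∀ k ∈ S, X k = Y k := fun S hS k hk =>
    hXY k (by rintro rfl; exact hS hk)
  have hsq : ∀ {u : EuclideanSpace ℝ (Fin d)}, ‖u‖ ≤ 2 * η * (N / τ) * L → ‖u‖ ^ 2 ≤ s * v :=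
    fun hu => (pow_le_pow_left₀ (norm_nonneg _) hu 2).trans hs
  have hab : ∀ S : Finset (Fin N), j ∈ S → ∀ θ,
      ‖gradStep ℓ r τ η X S θ - gradStep ℓ r τ η Y S θ‖ ^ 2 ≤ s * v := fun S hS θ => by
    have := norm_gradStep_sub_le r hL τ hη (Finset.notMem_erase j S) (Finset.notMem_erase j S)
      (hXS _ (Finset.notMem_erase j S)) θ
    rw [Finset.insert_erase hS] at this
    exact hsq this
  rcases eq_or_ne v 0 with rfl | hv
  · -- without noise the two updates have to coincide
    refine ⟨fun _ => 1, measurable_const, fun θ => ?_⟩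
    have hk : stepKernel ℓ r τ η 0 X θ = stepKernel ℓ r τ η 0 Y θ := by
      simp only [stepKernel, Kernel.coe_mk]
      congr 1
      refine Finset.sum_congr rfl fun S _ => ?_
      by_cases hS : j ∈ S
      · have h0 := hab S hS θ
        have h1 : ‖gradStep ℓ r τ η X S θ - gradStep ℓ r τ η Y S θ‖ ^ 2 = 0 :=
          le_antisymm (by simpa using h0) (sq_nonneg _)
        rw [sub_eq_zero.1 (norm_eq_zero.1 (pow_eq_zero_iff two_ne_zero |>.1 h1))]
      · rw [gradStep_congr ℓ r τ η (hXS S hS)]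
    rw [hk]
    have := isMarkovKernel_stepKernel ℓ r hτN η 0 Y
    refine IsApproxDensity.refl _ p _ ?_ ?_ <;>
    · rw [← ENNReal.ofReal_one]
      exact ENNReal.ofReal_le_ofReal (le_add_of_nonneg_right (by positivity))
  · refine ⟨fun z => ENNReal.ofReal (min (stepPDF ℓ r τ η v X z.1 z.2 / stepPDF ℓ r τ η v Y z.1 z.2)
      (1 + (τ / N : ℝ) * (Real.exp t - 1))), (((measurable_stepPDF ℓ r τ η v X).div
        (measurable_stepPDF ℓ r τ η v Y)).min measurable_const).ennreal_ofReal, fun θ => ?_⟩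
    rw [stepKernel_eq_withDensity ℓ r hτN η hv, stepKernel_eq_withDensity ℓ r hτN η hv]
    have hτ0 : (0 : ℝ) < τ := by exact_mod_cast hτ
    have hN0 : (0 : ℝ) < N := by exact_mod_cast hτ.trans hτN
    have hC : (0 : ℝ) < N.choose τ := by exact_mod_cast Nat.choose_pos hτN
    have hI : (swapPairs τ j).Nonempty := by
      rw [← Finset.card_pos, ← Nat.cast_pos (α := ℝ), card_swapPairs]
      positivity
    have hmem : ∀ x ∈ swapPairs τ j, j ∈ x.1 := fun x hx =>
      (Finset.mem_filter.1 (Finset.mem_product.1 hx).1).2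
    refine isApproxDensity_mixture hI (a := fun x => gradStep ℓ r τ η X x.1 θ)
      (b := fun x => gradStep ℓ r τ η Y x.1 θ)
      (c := fun x => gradStep ℓ r τ η Y (swapIn j x.1 x.2) θ) hv (by positivity) ht hl hp hpc
      (fun y => stepPDF_nonneg _ _ _ _ _ _ _ _) (fun y => ?_) (fun y => ?_)
      (fun x hx => hab x.1 (hmem x hx) θ) (fun x hx => ?_) (fun x hx => ?_)
    · rw [sum_swapPairs τ j fun S => isoPDF d v (gradStep ℓ r τ η Y S θ) y, card_swapPairs,
        stepPDF]
      field_simp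
    · rw [sum_swapPairs_fst τ j (fun S => isoPDF d v (gradStep ℓ r τ η X S θ) y -
        isoPDF d v (gradStep ℓ r τ η Y S θ) y)
        (fun S hS => by rw [gradStep_congr ℓ r τ η (hXS S hS), sub_self]), card_swapPairs,
        stepPDF, stepPDF, Finset.sum_sub_distrib]
      field_simp
      ring
    · by_cases hx2 : x.2 ∈ x.1
      · simpa [swapIn, hx2] using hab x.1 (hmem x hx) θ
      · have := norm_gradStep_sub_le r hL τ hη (Finset.notMem_erase j x.1)
          (fun h => hx2 (Finset.mem_of_mem_erase h)) (hXS _ (Finset.notMem_erase j x.1)) θ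
        rw [Finset.insert_erase (hmem x hx)] at this
        simpa [swapIn, hx2] using hsq this
    · by_cases hx2 : x.2 ∈ x.1
      · simpa [swapIn, hx2] using mul_nonneg hs0 v.2
      · have := norm_gradStep_sub_le r hL τ hη (X := Y) (Y := Y) (Finset.notMem_erase j x.1)
          (fun h => hx2 (Finset.mem_of_mem_erase h)) (fun _ _ => rfl) θ
        rw [Finset.insert_erase (hmem x hx)] at this
        simpa [swapIn, hx2] using hsq this

/-! ### Composition along the iteration -/

/-- The approximate density of all iterates is the product of those of the single updates. -/
lemma exists_isApproxDensity_iterates {τ : ℕ} (hτN : τ ≤ N)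
    {ℓ : 𝒳 → EuclideanSpace ℝ (Fin d) → ℝ} {r : EuclideanSpace ℝ (Fin d) → ℝ} {η : ℕ → ℝ}
    {v : ℕ → ℝ≥0} (μ₁ : Measure (EuclideanSpace ℝ (Fin d))) [IsProbabilityMeasure μ₁]
    {X Y : Fin N → 𝒳} {p : ℝ} (hp : 0 ≤ p) {c C δ : ℝ≥0∞}
    (hstep : ∀ t, ∃ g : EuclideanSpace ℝ (Fin d) × EuclideanSpace ℝ (Fin d) → ℝ≥0∞,
      Measurable g ∧ ∀ θ, IsApproxDensity (stepKernel ℓ r τ (η t) (v t) X θ)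
        (stepKernel ℓ r τ (η t) (v t) Y θ) (fun y => g (θ, y)) p c C δ) (K : ℕ) :
    ∃ G, IsApproxDensity (iterates ℓ r τ η v μ₁ X K) (iterates ℓ r τ η v μ₁ Y K) G p
      (c ^ K) (C ^ K) (K * δ) := by
  induction K with
  | zero =>
    have : IsProbabilityMeasure (iterates ℓ r τ η v μ₁ X 0) :=
      isProbabilityMeasure_iterates ℓ r hτN η v μ₁ X 0
    exact ⟨fun _ => 1, IsApproxDensity.refl _ p _ (by simp) (by simp)⟩
  | succ K ih =>
    obtain ⟨G, hG⟩ := ih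
    obtain ⟨g, hgm, hg⟩ := hstep (K + 1)
    have iX := isProbabilityMeasure_iterates ℓ r hτN η v μ₁ X K
    have iY := isProbabilityMeasure_iterates ℓ r hτN η v μ₁ Y K
    have kX := isMarkovKernel_stepKernel ℓ r hτN (η (K + 1)) (v (K + 1)) X
    have kY := isMarkovKernel_stepKernel ℓ r hτN (η (K + 1)) (v (K + 1)) Y
    have hlast : Measurable fun θ : Fin (K + 1) → EuclideanSpace ℝ (Fin d) => θ (Fin.last K) :=
      measurable_pi_apply _
    have hcomp := IsApproxDensity.compProd (κ := (stepKernel ℓ r τ (η (K + 1)) (v (K + 1)) X).comap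
        _ hlast) (κ' := (stepKernel ℓ r τ (η (K + 1)) (v (K + 1)) Y).comap _ hlast)
      (g := fun z => g (z.1 (Fin.last K), z.2)) hp hG
      (hgm.comp ((hlast.comp measurable_fst).prodMk measurable_snd)) fun θ => hg (θ (Fin.last K))
    have hinit : Measurable (Fin.init : (Fin (K + 2) → EuclideanSpace ℝ (Fin d)) → _) :=
      measurable_pi_lambda _ fun i => measurable_pi_apply _
    refine ⟨fun ω => G (Fin.init ω) *
      g (Fin.init ω (Fin.last K), ω (Fin.last (K + 1))), ?_⟩
    rw [pow_succ, pow_succ, Nat.cast_succ, add_mul, one_mul]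
    refine IsApproxDensity.map ?_ (measurable_snoc K) ?_ ?_
    · convert hcomp using 2 with z
      simp
    · exact (hG.measurable.comp hinit).mul
        (hgm.comp ((hlast.comp hinit).prodMk (measurable_pi_apply _)))
    · exact fun ω => mul_le_mul' (hG.le_bound _) ((hg _).le_bound _)

end SGLD

/-! ### Calibration of the noise -/

lemma log_two_div_gt {δ : ℝ} (hδ : 0 < δ) (hδ1 : δ < 1) : 69 / 100 < Real.log (2 / δ) := by
  have h : (2 : ℝ) ≤ 2 / δ := by rw [le_div_iff₀ hδ]; linarith
  linarith [Real.log_le_log two_pos h, Real.log_two_gt_d9]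

lemma three_quarters_le_log {K δ : ℝ} (hδ : 0 < δ) (hδ1 : δ < 1) (hK : 1 ≤ K) :
    3 / 4 ≤ Real.log (5 / 2 * K / δ) := by
  have h : (5 / 2 : ℝ) ≤ 5 / 2 * K / δ := by rw [le_div_iff₀ hδ]; nlinarith
  rw [Real.le_log_iff_exp_le (by positivity)]
  refine le_trans ?_ h
  have h1 : Real.exp (3 / 4) ^ 4 = Real.exp 1 ^ 3 := by
    rw [← Real.exp_nat_mul, ← Real.exp_nat_mul]; norm_num
  refine le_of_pow_le_pow_left₀ (n := 4) (by norm_num) (by norm_num) ?_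
  rw [h1]
  calc Real.exp 1 ^ 3 ≤ 2.72 ^ 3 := by gcongr; linarith [Real.exp_one_lt_d9]
    _ ≤ _ := by norm_num

lemma three_halves_le_log {K δ : ℝ} (hδ : 0 < δ) (hδ1 : δ < 1) (hK : 9 / 5 ≤ K) :
    3 / 2 ≤ Real.log (5 / 2 * K / δ) := by
  have h : (9 / 2 : ℝ) ≤ 5 / 2 * K / δ := by rw [le_div_iff₀ hδ]; nlinarith
  rw [Real.le_log_iff_exp_le (by positivity)]
  refine le_trans ?_ h
  have h1 : Real.exp (3 / 2) ^ 2 = Real.exp 1 ^ 3 := by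
    rw [← Real.exp_nat_mul, ← Real.exp_nat_mul]; norm_num
  refine le_of_pow_le_pow_left₀ (n := 2) (by norm_num) (by norm_num) ?_
  rw [h1]
  calc Real.exp 1 ^ 3 ≤ 2.7183 ^ 3 := by gcongr; linarith [Real.exp_one_lt_d9]
    _ ≤ _ := by norm_num

/-- The constant is slightly more than `1 + √2`. -/
lemma exp_sub_one_le_mul {t : ℝ} (ht : 0 ≤ t) (ht2 : t ^ 2 ≤ 2) :
    Real.exp t - 1 ≤ 242 / 100 * t := by
  have h : t ≤ 142 / 100 := abs_le_of_sq_le_sq' (by linarith) (by norm_num) |>.2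
  nlinarith [exp_le_one_add_add_sq (x := t) (by linarith)]

/-- The exceptional masses of all the updates add up to at most `δ / 2`. -/
lemma exceptional_mass_le {K q δ t : ℝ} (hδ : 0 < δ) (hK : 0 < K) (hq : q ≤ 1)
    (ht2 : t ^ 2 ≤ 2) :
    K * (q * (2⁻¹ * Real.exp (t / 2 - Real.log (5 / 2 * K / δ)))) ≤ δ / 2 := by
  have h : t ≤ 3 / 2 := abs_le_of_sq_le_sq' (by linarith) (by norm_num) |>.2
  have h1 : Real.exp (t / 2) ≤ 5 / 2 := by
    have := exp_le_one_add_add_sq (x := t / 2) (by linarith)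
    nlinarith
  rw [Real.exp_sub, Real.exp_log (by positivity)]
  calc K * (q * (2⁻¹ * (Real.exp (t / 2) / (5 / 2 * K / δ))))
      = q * (Real.exp (t / 2) * (δ / 5)) := by field_simp
    _ ≤ 1 * (5 / 2 * (δ / 5)) := by gcongr
    _ = δ / 2 := by ring

lemma sq_two_mul_add_le {a ε : ℝ} (ha : 69 / 100 < a) (hε2 : ε ^ 2 < 4 * a) :
    (2 * a + ε) ^ 2 ≤ 20 * a ^ 2 := by
  have h : ε ≤ 241 / 100 * a := abs_le_of_sq_le_sq' (by nlinarith) (by linarith) |>.2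
  nlinarith

/-- Few updates: the cut-offs alone multiply to at most `e^ε`. -/
lemma pow_cutoff_le {K q a t ε : ℝ} {k : ℕ} (hk : (k : ℝ) ≤ K) (hK : 0 < K) (hq : 0 < q)
    (hε : 0 < ε) (ht : 0 ≤ t) (ht2 : t ^ 2 ≤ 2)
    (htε : t ^ 2 * (16 * q ^ 2 * a * K) = ε ^ 2) (hKa : (242 / 100) ^ 2 * K ≤ 16 * a) :
    (1 + q * (Real.exp t - 1)) ^ k ≤ Real.exp ε := by
  have hc0 : 0 ≤ Real.exp t - 1 := by linarith [Real.add_one_le_exp t]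
  have hqc : 0 ≤ q * (Real.exp t - 1) := mul_nonneg hq.le hc0
  have h1 : (1 + q * (Real.exp t - 1)) ^ k ≤ Real.exp (k * (q * (Real.exp t - 1))) := by
    rw [Real.exp_nat_mul]
    gcongr
    linarith [Real.add_one_le_exp (q * (Real.exp t - 1))]
  refine h1.trans (Real.exp_le_exp.2 ?_)
  calc (k : ℝ) * (q * (Real.exp t - 1)) ≤ K * (q * (242 / 100 * t)) := by
        gcongr
        exact exp_sub_one_le_mul ht ht2
    _ ≤ ε := by
        refine abs_le_of_sq_le_sq' ?_ hε.le |>.2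
        rw [← htε]
        have : 0 ≤ t ^ 2 * q ^ 2 * K * (16 * a - (242 / 100) ^ 2 * K) :=
          mul_nonneg (by positivity) (by linarith)
        nlinarith

/-- Many updates: the order `1 + 2 a / ε` is admissible for the moment bound. -/
lemma moment_order_mul_le {K q a t ε : ℝ} (hK : 0 < K) (hq : 0 < q) (ha : 69 / 100 < a)
    (hε : 0 < ε) (hε2 : ε ^ 2 < 4 * a) (ht : 0 ≤ t) (ht2 : t ^ 2 ≤ 2)
    (htε : t ^ 2 * (16 * q ^ 2 * a * K) = ε ^ 2) (hKa : 16 * a ≤ (242 / 100) ^ 2 * K) :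
    (1 + 2 * a / ε) * (q * (Real.exp t - 1)) ≤ 17 / 10 := by
  have hp : 0 ≤ 1 + 2 * a / ε := by positivity
  calc (1 + 2 * a / ε) * (q * (Real.exp t - 1)) ≤ (1 + 2 * a / ε) * (q * (242 / 100 * t)) := by
        gcongr
        exact exp_sub_one_le_mul ht ht2
    _ ≤ 17 / 10 := by
        refine abs_le_of_sq_le_sq' ?_ (by norm_num) |>.2
        have e : ((1 + 2 * a / ε) * (q * (242 / 100 * t))) ^ 2 =
            (2 * a + ε) ^ 2 * ((242 / 100) ^ 2) / (16 * a * K) := by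
          have h1 : t ^ 2 = ε ^ 2 / (16 * q ^ 2 * a * K) := by
            rw [eq_div_iff (by positivity), htε]
          rw [mul_pow, mul_pow, mul_pow, h1]
          field_simp
          ring
        rw [e, div_le_iff₀ (by positivity)]
        have h2 := sq_two_mul_add_le ha hε2
        nlinarith

/-- Many updates: the moment bound and Markov's inequality at the order `1 + 2 a / ε` leave at most
the mass `exp (-a)`. -/
lemma pow_moment_mul_exp_le {K q a b t ε : ℝ} {k : ℕ} (hk : (k : ℝ) ≤ K) (hK : 0 < K)
    (hq : 0 < q) (ha : 69 / 100 < a) (hb : 3 / 2 ≤ b) (hε : 0 < ε) (hε2 : ε ^ 2 < 4 * a)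
    (ht2 : t ^ 2 ≤ 2) (htε : t ^ 2 * (16 * q ^ 2 * a * K) = ε ^ 2) :
    (1 + (1 + 2 * a / ε) ^ 2 * (q ^ 2 * (t ^ 2 / (2 * b) * Real.exp (t ^ 2 / (2 * b))))) ^ k *
      Real.exp (-(2 * a)) ≤ Real.exp (-a) := by
  have hs : t ^ 2 / (2 * b) ≤ 2 / 3 := by
    rw [div_le_iff₀ (by linarith)]; linarith
  have hes : Real.exp (t ^ 2 / (2 * b)) ≤ 2.2 :=
    (exp_le_one_add_add_sq (by linarith)).trans (by
      have : 0 ≤ t ^ 2 / (2 * b) := by positivity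
      nlinarith)
  set u := (1 + 2 * a / ε) ^ 2 * (q ^ 2 * (t ^ 2 / (2 * b) * Real.exp (t ^ 2 / (2 * b)))) with hu
  have hu0 : 0 ≤ u := by positivity
  have h1 : (1 + u) ^ k ≤ Real.exp (k * u) := by
    rw [Real.exp_nat_mul]
    gcongr
    linarith [Real.add_one_le_exp u]
  have h2 : k * u ≤ a := by
    calc k * u ≤ K * u := by gcongr
      _ = (2 * a + ε) ^ 2 / (32 * a * b) * Real.exp (t ^ 2 / (2 * b)) := by
          have h1 : t ^ 2 = ε ^ 2 / (16 * q ^ 2 * a * K) := by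
            rw [eq_div_iff (by positivity), htε]
          have h3 : K * ((1 + 2 * a / ε) ^ 2 * (q ^ 2 * (t ^ 2 / (2 * b)))) =
              (2 * a + ε) ^ 2 / (32 * a * b) := by
            rw [h1]
            field_simp
            ring
          rw [← h3, hu]; ring
      _ ≤ 20 * a ^ 2 / (32 * a * (3 / 2)) * 2.2 := by
          gcongr
          exact sq_two_mul_add_le ha hε2
      _ ≤ a := by
          rw [show 20 * a ^ 2 / (32 * a * (3 / 2)) * 2.2 = 44 / 48 * a by field_simp; norm_num]
          linarith
  calc (1 + u) ^ k * Real.exp (-(2 * a)) ≤ Real.exp a * Real.exp (-(2 * a)) := by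
        gcongr
        exact h1.trans (Real.exp_le_exp.2 h2)
    _ = Real.exp (-a) := by rw [← Real.exp_add]; congr 1; ring

namespace SGLD

open scoped Classical in
lemma exists_forall_ne_eq_of_hammingDist_le_one {𝒳 : Type*} {N : ℕ} (hN : 0 < N)
    {X Y : Fin N → 𝒳} (h : hammingDist X Y ≤ 1) : ∃ j, ∀ k, k ≠ j → X k = Y k := by
  have : Nonempty (Fin N) := ⟨⟨0, hN⟩⟩
  rw [hammingDist, Finset.card_le_one_iff_subset_singleton] at h
  obtain ⟨j, hj⟩ := h
  refine ⟨j, fun k hk => ?_⟩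
  by_contra hne
  exact hk (Finset.mem_singleton.1 (hj (by simpa using hne)))

/-- Differential privacy of the iterates for all noise levels above the calibrated one. -/
theorem isDifferentiallyPrivate_iterates {𝒳 : Type*} {d N τ : ℕ} (hτ : 1 ≤ τ) (hτN : τ ≤ N)
    (ℓ : 𝒳 → EuclideanSpace ℝ (Fin d) → ℝ) (r : EuclideanSpace ℝ (Fin d) → ℝ)
    (L : ℝ≥0) (hL : ∀ x, LipschitzWith L (ℓ x))
    (μ₁ : Measure (EuclideanSpace ℝ (Fin d))) [IsProbabilityMeasure μ₁]
    (η : ℕ → ℝ) (hη : ∀ t, 0 < η t)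
    (T ε δ : ℝ) (hε : 0 < ε) (hδ : 0 < δ) (hδ1 : δ < 1)
    (hεδ : ε < 2 * Real.sqrt (Real.log (2 / δ)))
    (hT : ε ^ 2 * N / (32 * τ * Real.log (2 / δ)) ≤ T) (v : ℕ → ℝ≥0)
    (hv : ∀ t, privacyFactor N τ T ε δ L * η t ^ 2 ≤ v t) (k : ℕ) (hkK : (k : ℝ) ≤ N * T / τ) :
    IsDifferentiallyPrivate (fun X : Fin N → 𝒳 => iterates ℓ r τ η v μ₁ X k) ε δ := by
  intro X Y hXY S hS
  beta_reduce
  rcases Nat.eq_zero_or_pos k with rfl | hkpos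
  · -- the initial law does not depend on the data
    have h1 : (1 : ℝ≥0∞) ≤ ENNReal.ofReal (Real.exp ε) := by
      rw [← ENNReal.ofReal_one]
      exact ENNReal.ofReal_le_ofReal (Real.one_le_exp hε.le)
    exact (le_mul_of_one_le_left' h1).trans le_self_add
  have hτ0 : (0 : ℝ) < τ := by exact_mod_cast hτ
  have hN : 0 < N := hτ.trans hτN
  have hN0 : (0 : ℝ) < N := by exact_mod_cast hN
  obtain ⟨j, hj⟩ := exists_forall_ne_eq_of_hammingDist_le_one hN hXY
  set a := Real.log (2 / δ) with hadef
  set K := (N : ℝ) * T / τ with hKdef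
  have hK1 : 1 ≤ K := le_trans (by exact_mod_cast hkpos) hkK
  have hK0 : 0 < K := by linarith
  set q := (τ : ℝ) / N with hqdef
  have hq0 : 0 < q := by positivity
  have hq1 : q ≤ 1 := by
    rw [hqdef, div_le_one hN0]; exact_mod_cast hτN
  set b := Real.log (5 / 2 * K / δ) with hbdef
  have ha : 69 / 100 < a := log_two_div_gt hδ hδ1
  have ha0 : 0 < a := by linarith
  have hb : 3 / 4 ≤ b := three_quarters_le_log hδ hδ1 hK1
  have hε2 : ε ^ 2 < 4 * a := by
    calc ε ^ 2 < (2 * √a) ^ 2 := by gcongr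
      _ = 4 * a := by rw [mul_pow, Real.sq_sqrt ha0.le]; norm_num
  -- `t` bounds the privacy loss of one Gaussian step up to mass `exp (t / 2 - b)`,
  -- and `s` bounds its squared sensitivity relative to the noise variance
  set t := ε / √(16 * q ^ 2 * a * K) with htdef
  have ht0 : 0 < t := by positivity
  have htε : t ^ 2 * (16 * q ^ 2 * a * K) = ε ^ 2 := by
    rw [htdef, div_pow, Real.sq_sqrt (by positivity)]
    field_simp
  have ht2 : t ^ 2 ≤ 2 := by
    have h1 : ε ^ 2 ≤ 32 * (q ^ 2 * a * K) := by
      rw [div_le_iff₀ (by positivity)] at hT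
      have e : 32 * (q ^ 2 * a * K) = T * (32 * τ * a) / N := by
        rw [hqdef, hKdef]; field_simp
      rw [e, le_div_iff₀ hN0]
      exact hT
    have h2 : 0 < q ^ 2 * a * K := by positivity
    nlinarith
  set s := t ^ 2 / (2 * b) with hsdef
  have hs0 : 0 < s := by positivity
  -- `2 b / t = t / s` is the exponent that optimizes the Chernoff bound
  have hl : 1 ≤ 2 * b / t := by
    rw [one_le_div ht0]
    exact (abs_le_of_sq_le_sq' (by linarith : t ^ 2 ≤ (3 / 2) ^ 2) (by norm_num)).2.trans
      (by linarith)
  have hexp : (2 * b / t) * (2 * b / t + 1) * s / 2 - 2 * b / t * t = t / 2 - b := by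
    rw [hsdef]; field_simp; ring
  have hsens : ∀ i, (2 * η i * (N / τ) * L) ^ 2 ≤ s * v i := by
    intro i
    refine le_trans (le_of_eq ?_) (mul_le_mul_of_nonneg_left (hv i) hs0.le)
    have e1 : Real.log (2.5 * N * T / (τ * δ)) = b := by
      rw [hbdef, hKdef]; congr 1; field_simp; ring
    have e2 : s = ε ^ 2 / (32 * q ^ 2 * a * K * b) := by
      rw [hsdef, ← htε]; field_simp; norm_num
    have e3 : (128 : ℝ) * N * T * L ^ 2 / (τ * ε ^ 2) = 128 * K * L ^ 2 / ε ^ 2 := by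
      rw [hKdef]; field_simp
    have e4 : (N : ℝ) / τ = q⁻¹ := by rw [hqdef, inv_div]
    rw [privacyFactor, e1, e2, e3, e4, ← hadef]
    field_simp
    ring
  have hstep : ∀ p : ℝ, 0 ≤ p → p * (q * (Real.exp t - 1)) ≤ 17 / 10 → _ := fun p hp hpc =>
    exists_isApproxDensity_iterates hτN μ₁ hp (fun i =>
      exists_isApproxDensity_stepKernel hτ hτN r hL (hη i).le hj hs0.le (hsens i) ht0.le hl hp
        hpc) k
  rw [hexp] at hstep
  have hmass : (k : ℝ≥0∞) * ENNReal.ofReal (q * (2⁻¹ * Real.exp (t / 2 - b))) ≤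
      ENNReal.ofReal (δ / 2) := by
    rw [← ENNReal.ofReal_natCast, ← ENNReal.ofReal_mul (by positivity)]
    refine ENNReal.ofReal_le_ofReal (le_trans ?_
      (exceptional_mass_le hδ hK0 hq1 ht2))
    gcongr
  have hqc : 0 ≤ q * (Real.exp t - 1) :=
    mul_nonneg hq0.le (by linarith [Real.add_one_le_exp t])
  rcases le_total ((242 / 100) ^ 2 * K) (16 * a) with hKa | hKa
  · -- the moment plays no role here, so any order will do
    obtain ⟨G, hG⟩ := hstep 0 le_rfl (by norm_num)
    refine (hG.measure_le_of_bound hS).trans ?_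
    gcongr
    · rw [← ENNReal.ofReal_pow (by linarith)]
      exact ENNReal.ofReal_le_ofReal
        (pow_cutoff_le hkK hK0 hq0 hε ht0.le ht2 htε hKa)
    · exact hmass.trans (ENNReal.ofReal_le_ofReal (by linarith))
  · obtain ⟨G, hG⟩ := hstep (1 + 2 * a / ε) (by positivity)
      (moment_order_mul_le hK0 hq0 ha hε hε2 ht0.le ht2 htε hKa)
    have hb' : 3 / 2 ≤ b := three_halves_le_log hδ hδ1 (by linarith)
    refine (hG.measure_le_of_moment (w := ENNReal.ofReal (Real.exp ε)) (by positivity)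
      (by simp [Real.exp_pos]) ENNReal.ofReal_ne_top
      (ENNReal.pow_ne_top ENNReal.ofReal_ne_top) hS).trans ?_
    gcongr
    rw [ENNReal.ofReal_rpow_of_pos (Real.exp_pos ε), ← ENNReal.ofReal_pow (by positivity),
      ← ENNReal.ofReal_mul (by positivity), ← Real.exp_mul,
      show ε * -(2 * a / ε) = -(2 * a) by field_simp]
    have hlast := pow_moment_mul_exp_le hkK hK0 hq0 ha hb' hε hε2 ht2 htε
    have hδ2 : Real.exp (-a) = δ / 2 := by
      rw [hadef, Real.exp_neg, Real.exp_log (by positivity), inv_div]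
    rw [show δ = δ / 2 + δ / 2 by ring, ENNReal.ofReal_add (by positivity) (by positivity)]
    exact add_le_add (ENNReal.ofReal_le_ofReal (hlast.trans_eq hδ2)) hmass

end SGLD

theorem mainTheorem2 {𝒳 : Type*} {d N τ : ℕ} (hτ : 1 ≤ τ) (hτN : τ ≤ N)
    (ℓ : 𝒳 → EuclideanSpace ℝ (Fin d) → ℝ) (r : EuclideanSpace ℝ (Fin d) → ℝ)
    (L : ℝ≥0) (hℓ : ∀ x, Differentiable ℝ (ℓ x)) (hL : ∀ x, LipschitzWith L (ℓ x))
    (hr : Differentiable ℝ r)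
    (μ₁ : Measure (EuclideanSpace ℝ (Fin d))) [IsProbabilityMeasure μ₁]
    (η : ℕ → ℝ) (hη : ∀ t, 0 < η t)
    (T ε δ : ℝ) (hε : 0 < ε) (hδ : 0 < δ) (hδ1 : δ < 1)
    (hεδ : ε < 2 * Real.sqrt (Real.log (2 / δ)))
    (hT : ε ^ 2 * N / (32 * τ * Real.log (2 / δ)) ≤ T) :
    IsDifferentiallyPrivate
        (fun X : Fin N → 𝒳 => SGLD.dpSGLD ℓ r τ T ε δ L η μ₁ X) ε δ ∧
      ∀ v : ℕ → ℝ≥0,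
        (∀ t, SGLD.privacyFactor N τ T ε δ L * η t ^ 2 ≤ v t) →
        IsDifferentiallyPrivate
          (fun X : Fin N → 𝒳 => SGLD.iterates ℓ r τ η v μ₁ X ⌊(N : ℝ) * T / τ⌋₊) ε δ := by
  have hT0 : 0 ≤ T := by
    have := log_two_div_gt hδ hδ1
    exact le_trans (by positivity) hT
  have main : ∀ v : ℕ → ℝ≥0, (∀ t, SGLD.privacyFactor N τ T ε δ L * η t ^ 2 ≤ v t) →
      IsDifferentiallyPrivate
        (fun X : Fin N → 𝒳 => SGLD.iterates ℓ r τ η v μ₁ X ⌊(N : ℝ) * T / τ⌋₊) ε δ :=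
    fun v hv => SGLD.isDifferentiallyPrivate_iterates hτ hτN ℓ r L hL μ₁ η hη T ε δ hε hδ hδ1 hεδ
      hT v hv _ (Nat.floor_le (by positivity))
  exact ⟨main _ fun t => (le_max_left _ _).trans (Real.le_coe_toNNReal _), main⟩
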